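/- **Model.** Let $G=(V,E)$ be a finite connected graph with $n$ vertices and a start vertex $v_1$. A quantum robot on $G$ has basis states $|v,z\rangle$ with $v\in V$ a location and $z$ a bit string of some fixed (arbitrarily large) positive length. Given an input $X=(x_v)_{v\in V}\in\{0,1\}^V$, it starts in $|v_1,0\rangle$ and undergoes $T$ *steps*, the $t$-th of which applies a unitary $U^{(t)}$ followed by the oracle $O_X$, which maps $|v,z\rangle$ to $|v,z\oplus x_v\rangle$ with $x_v$ XORed into the first bit of $z$. The unitaries $U^{(t)}$ do not depend on $X$ and are *C-local*: the basis states can be partitioned into subsets such that all entries of $U^{(t)}$ between distinct subsets vanish, and the basis states of each subset all come from one vertex or from two adjacent vertices. For a partial Boolean function $f$ on $\{0,1\}^V$, let $Q(f,G)$ be the least $T$ for which some robot on $G$ has, for every $X$ in the domain of $f$, a designated bit of $z$ equal to $f(X)$ with probability at least $2/3$ when the final state is measured. **Dimension.** For real $d$ and $\kappa>0$, call $G$ *$d$-dimensional with constant $\kappa$* if it is connected and, for every vertex $v$ and every integer $\ell\ge 0$, the ball $B(v,\ell)$ of vertices at distance at most $\ell$ from $v$ satisfies $|B(v,\ell)|\ge\min(\kappa\ell^d,n)$.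 (A family of graphs is $d$-dimensional if one $\kappa>0$ works for all its members.) **Problem.** Given a known set $H\subseteq V$ of $h$ potentially marked vertices and $k\ge 1$, let $\mathrm{OR}^{(h,\ge k)}$ be the problem of deciding whether $X$ has no marked vertices (vertices $v$ with $x_v=1$) or at least $k$ of them, given that all marked vertices lie in $H$ and that one of these two cases holds. **Proposition.** Let $d>2$ be a real constant. If $G$ is $d$-dimensional, then $$Q\bigl(\mathrm{OR}^{(h,\ge k)},G\bigr)=O\!\left(n^{1/d}\left(\frac hk\right)^{1/2-1/d}\operatorname{polylog}\frac hk\right).$$ Precisely: for all real $d>2$ and $\kappa>0$ there are a constant $C>0$ and a natural number $c$ such that, for every graph $G$ that is $d$-dimensional with constant $\kappa$, with $n$ vertices, every start vertex $v_1$, every set $H$ of $h$ vertices and every integer $k$ with $1\le k\le h$, $$Q\bigl(\mathrm{OR}^{(h,\ge k)},G\bigr)\le C\,n^{1/d}\left(\frac hk\right)^{1/2-1/d}\log^c\!\left(2+\frac hk\right).$$ -/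

import Mathlib

namespace SpatialSearch

/-- The graph `G` is connected and satisfies the volume-growth condition of a `d`-dimensional
family with constant `κ`: every ball `B(v, ℓ)` has at least `min (κ ℓ ^ d) n` vertices, where `n`
is the number of vertices. A family of graphs is `d`-dimensional if one `κ > 0` works for all of
its members. -/
structure IsDimensional {V : Type*} [Fintype V] (d κ : ℝ) (G : SimpleGraph V) : Prop where
  connected : G.Connected
  growth : ∀ (v : V) (l : ℕ),
    min (κ * (l : ℝ) ^ d) (Fintype.card V : ℝ) ≤ (Set.ncard {w : V | G.dist v w ≤ l} : ℝ)

/-- Internal configurations of a robot: bit strings of length `m + 1`. The first bit is bit `0`. -/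
abbrev Config (m : ℕ) : Type := Fin (m + 1) → Bool

/-- Labels of the basis states `|v, z⟩`: a location together with an internal configuration. -/
abbrev Basis (V : Type*) (m : ℕ) : Type _ := V × Config m

/-- C-locality: the basis states are partitioned (into the classes of `P`) so that `U` has zero
entries between states of distinct classes, and all states of a class come from a single vertex or
from two adjacent vertices. `U b' b` is the entry in column `b` and row `b'`. -/
def IsCLocal {V : Type*} {m : ℕ} (G : SimpleGraph V)
    (U : Matrix (Basis V m) (Basis V m) ℂ) : Prop :=
  ∃ P : Setoid (Basis V m),
    (∀ b b' : Basis V m, ¬ P b b' → U b' b = 0) ∧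
    (∀ b : Basis V m, (∃ v : V, ∀ b', P b b' → b'.1 = v) ∨
      (∃ v w : V, G.Adj v w ∧ ∀ b', P b b' → b'.1 = v ∨ b'.1 = w))

/-- A quantum robot on `G`: a number of memory bits, the algorithm steps `U⁽¹⁾, U⁽²⁾, …`
(`step t` is `U⁽ᵗ⁺¹⁾`; a run of length `T` uses only the first `T` of them), which are unitary,
C-local and do not depend on the input, and the position of the output bit. -/
structure Robot {V : Type*} [Fintype V] [DecidableEq V] (G : SimpleGraph V) where
  mem : ℕ
  step : ℕ → Matrix (Basis V mem) (Basis V mem) ℂ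
  step_unitary : ∀ t, step t ∈ Matrix.unitaryGroup (Basis V mem) ℂ
  step_local : ∀ t, IsCLocal G (step t)
  out : Fin (mem + 1)

/-- The oracle on basis states for the input `X`: the bit `X v` is XORed into the first bit. -/
def oracleMap {V : Type*} {m : ℕ} (X : V → Bool) (b : Basis V m) : Basis V m :=
  (b.1, Function.update b.2 0 (xor (b.2 0) (X b.1)))

theorem oracleMap_involutive {V : Type*} {m : ℕ} (X : V → Bool) :
    Function.Involutive (oracleMap (m := m) X) := by
  intro b
  simp [oracleMap]

/-- The oracle step on states. Since `oracleMap X` is an involution, precomposing amplitudes with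
it is the linear map that sends each basis state `|b⟩` to `|oracleMap X b⟩`. -/
def oracleStep {V : Type*} {m : ℕ} (X : V → Bool) (ψ : Basis V m → ℂ) : Basis V m → ℂ :=
  fun b => ψ (oracleMap X b)

theorem oracleStep_single {V : Type*} [DecidableEq V] {m : ℕ} (X : V → Bool) (b : Basis V m) :
    oracleStep X (Pi.single b (1 : ℂ)) = Pi.single (oracleMap X b) (1 : ℂ) := by
  funext b'
  have h : oracleMap X b' = b ↔ b' = oracleMap X b :=
    ⟨fun h => by rw [← h, oracleMap_involutive X b'],
      fun h => by rw [h, oracleMap_involutive X b]⟩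
  simp [oracleStep, Pi.single_apply, h]

/-- The state on input `X` immediately after the `t`-th oracle step, started in `|v₁, 0⟩`. -/
noncomputable def Robot.state {V : Type*} [Fintype V] [DecidableEq V] {G : SimpleGraph V}
    (A : Robot G) (v₁ : V) (X : V → Bool) : ℕ → Basis V A.mem → ℂ
  | 0 => Pi.single (v₁, fun _ => false) 1
  | t + 1 => oracleStep X ((A.step t).mulVec (A.state v₁ X t))

/-- The probability that the output bit equals `y` when the robot stops after `T` steps. -/
noncomputable def Robot.prob {V : Type*} [Fintype V] [DecidableEq V] {G : SimpleGraph V}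
    (A : Robot G) (v₁ : V) (T : ℕ) (X : V → Bool) (y : Bool) : ℝ :=
  ∑ b : Basis V A.mem with b.2 A.out = y, ‖A.state v₁ X T b‖ ^ 2

/-- A partial Boolean function of the bits at the vertices; `none` means undefined. -/
abbrev PartialBool (V : Type*) : Type _ := (V → Bool) → Option Bool

/-- Within `T` steps, the robot evaluates `f` with probability at least `2 / 3` on all inputs in
the domain of `f`. -/
def Robot.Computes {V : Type*} [Fintype V] [DecidableEq V] {G : SimpleGraph V}
    (A : Robot G) (v₁ : V) (T : ℕ) (f : PartialBool V) : Prop :=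
  ∀ (X : V → Bool) (y : Bool), f X = some y → 2 / 3 ≤ A.prob v₁ T X y

/-- `Q(f, G)`: the minimum number `T` of steps for which some quantum robot on `G`, started at
`v₁`, evaluates `f` (it is `⊤` if there is no such `T`). -/
noncomputable def queryComplexity {V : Type*} [Fintype V] [DecidableEq V] (f : PartialBool V)
    (G : SimpleGraph V) (v₁ : V) : ℕ∞ :=
  ⨅ (T : ℕ) (_ : ∃ A : Robot G, A.Computes v₁ T f), (T : ℕ∞)

/-- The vertices marked by the input `X`. -/
def marked {V : Type*} [Fintype V] (X : V → Bool) : Finset V :=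
  Finset.univ.filter fun v => X v = true

/-- The problem `OR^(h, ≥ k)` for the known set `H` of `h` potentially marked vertices: decide
whether there are no marked vertices or at least `k` of them, given that all marked vertices
belong to `H` and that one of the two cases holds. -/
def orAtLeast {V : Type*} [Fintype V] [DecidableEq V] (H : Finset V) (k : ℕ) : PartialBool V :=
  fun X =>
    if marked X = ∅ then some false
    else if marked X ⊆ H ∧ k ≤ (marked X).card then some true
    else none

end SpatialSearch

/-! The robot runs a quantum walk on an electric network: a tree of nested scales drawn in `G`. Put
r = h/k and R = (n/r)^(1/d).

Walk. Every edge of a network gets two darts, and a dangling dart is attached to the root. Let U be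
the product of the reflections in the stars of the nodes (with the marked leaves removed) and in the
edges. If no leaf is marked, the root dart is, up to a factor 2, of the form U w - w, where the
squared norm of w is governed by the total weight of the network; its orbit sum telescopes, so the
mean of its first M iterates has norm at most ‖w‖/M (`sum_norm_sq_cesaro_le`). A unit flow from the
root to marked leaves yields a vector invariant under U that overlaps the root dart, so the mean
stays large when the flow has small energy (`sq_le_mul_sum_norm_sq_cesaro`). A clock in uniform
superposition turns the squared norm of the mean into an output probability. All operators involved
are local reflections (`exists_robot_phase_detection`, `exists_robot_of_network`).

Tree. The leaves are the elements of H, level i ≥ 1 is a maximal set of vertices with distances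
greater than 2 D_i, where D_i = 2^i ⌈R⌉, and the top is v₁. Tree edges become lazy paths in `G`. If
level i has at most ν_i nodes and the squares of the flow across it sum to at most μ_i, then the
edge weight √(μ_i/ν_i) balances weight against energy, and the number of steps is of order ∑ len_i
√(μ_i ν_i) (`exists_robot_of_tree`). At the leaves ν = h and μ = 1/k, since the flow is spread over
at least k of them; this level costs about R √r = n^(1/d) r^(1/2-1/d). Above, μ = 1, and disjoint
balls give ν_i = r 2^(-id)/κ. The lengths double while √ν_i shrinks by 2^(-d/2), so for d > 2 the
costs form a convergent geometric series (`sum_scales_le`). No logarithm appears. -/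

namespace SpatialSearch

open scoped Matrix

/-! ### Block reflections and their locality. -/

/-- The matrix that acts on every fibre of `f` as the reflection through the hyperplane orthogonal
to the restriction of `a` to this fibre (and as the identity if this restriction vanishes). -/
noncomputable def blockRefl {ι κ : Type*} [Fintype ι] [DecidableEq ι] [DecidableEq κ]
    (f : ι → κ) (a : ι → ℝ) : Matrix ι ι ℂ :=
  1 - Matrix.of fun i j =>
    if f i = f j then ((2 * a i * a j / ∑ l with f l = f i, a l ^ 2 : ℝ) : ℂ) else 0

section BlockRefl

variable {ι κ : Type*} [Fintype ι] [DecidableEq κ] {f : ι → κ} {a : ι → ℝ}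

theorem eq_zero_of_fibre_sum_eq_zero {i : ι} (h : ∑ l with f l = f i, a l ^ 2 = 0) : a i = 0 := by
  have := (Finset.sum_eq_zero_iff_of_nonneg fun l _ => sq_nonneg (a l)).1 h i (by simp)
  exact pow_eq_zero_iff (two_ne_zero) |>.1 this

variable [DecidableEq ι]

theorem blockRefl_mulVec_apply (x : ι → ℂ) (i : ι) :
    (blockRefl f a *ᵥ x) i = x i - ((2 * a i / ∑ l with f l = f i, a l ^ 2 : ℝ) : ℂ) *
      ∑ l with f l = f i, (a l : ℂ) * x l := by
  rw [blockRefl, Matrix.sub_mulVec, Matrix.one_mulVec, Pi.sub_apply, Matrix.mulVec, dotProduct,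
    Finset.mul_sum, Finset.sum_filter]
  congr 1
  refine Finset.sum_congr rfl fun j _ => ?_
  by_cases h : f i = f j
  · simp only [Matrix.of_apply, h, if_true]
    push_cast
    ring
  · simp [h, Ne.symm h]

theorem blockRefl_transpose : (blockRefl f a)ᵀ = blockRefl f a := by
  ext i j
  simp only [blockRefl, Matrix.transpose_apply, Matrix.sub_apply, Matrix.of_apply, Matrix.one_apply]
  by_cases h : f i = f j
  · rw [if_pos h, if_pos h.symm, h]
    simp only [eq_comm (a := j)]
    congr 3
    ring
  · rw [if_neg h, if_neg (Ne.symm h)]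
    simp only [eq_comm (a := j)]

theorem blockRefl_star : star (blockRefl f a) = blockRefl f a := by
  have h : star (blockRefl f a) = ((blockRefl f a)ᵀ).map star := rfl
  rw [h, blockRefl_transpose]
  ext i j
  simp only [blockRefl, Matrix.map_apply, Matrix.sub_apply, Matrix.of_apply, Matrix.one_apply]
  split_ifs <;> simp

/-- A vector orthogonal to `a` on every fibre is fixed. -/
theorem blockRefl_mulVec_of_orthogonal {x : ι → ℂ}
    (h : ∀ i, ∑ l with f l = f i, (a l : ℂ) * x l = 0) : blockRefl f a *ᵥ x = x := by
  ext i
  rw [blockRefl_mulVec_apply, h, mul_zero, sub_zero]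

/-- A vector proportional to `a` on every fibre is negated. -/
theorem blockRefl_mulVec_of_proportional (c : κ → ℂ) :
    blockRefl f a *ᵥ (fun i => (a i : ℂ) * c (f i)) = -fun i => (a i : ℂ) * c (f i) := by
  ext i
  rw [blockRefl_mulVec_apply, Pi.neg_apply]
  have h1 : ∑ l with f l = f i, (a l : ℂ) * ((a l : ℂ) * c (f l))
      = ((∑ l with f l = f i, a l ^ 2 : ℝ) : ℂ) * c (f i) := by
    push_cast
    rw [Finset.sum_mul]
    refine Finset.sum_congr rfl fun l hl => ?_
    rw [(Finset.mem_filter.1 hl).2]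
    ring
  rw [h1]
  -- If `a` vanishes on the fibre, the division by zero is harmless: both sides are 0.
  by_cases h : ∑ l with f l = f i, a l ^ 2 = 0
  · simp [eq_zero_of_fibre_sum_eq_zero h]
  · have h' : ((∑ l with f l = f i, a l ^ 2 : ℝ) : ℂ) ≠ 0 := by exact_mod_cast h
    rw [Complex.ofReal_div, ← mul_assoc, div_mul_cancel₀ _ h']
    push_cast
    ring

theorem blockRefl_mul_self : blockRefl f a * blockRefl f a = 1 := by
  rw [← Matrix.mulVec_injective.eq_iff]
  ext x : 1
  rw [← Matrix.mulVec_mulVec, Matrix.one_mulVec]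
  set c : κ → ℂ := fun k => ((2 / ∑ l with f l = k, a l ^ 2 : ℝ) : ℂ) *
    ∑ l with f l = k, (a l : ℂ) * x l
  have h1 : blockRefl f a *ᵥ x = x - fun i => (a i : ℂ) * c (f i) := by
    ext i
    rw [blockRefl_mulVec_apply, Pi.sub_apply]
    simp only [c]
    push_cast
    ring
  rw [h1, Matrix.mulVec_sub, h1, blockRefl_mulVec_of_proportional]
  simp

theorem blockRefl_mem_unitaryGroup : blockRefl f a ∈ Matrix.unitaryGroup ι ℂ := by
  rw [Matrix.mem_unitaryGroup_iff, blockRefl_star, blockRefl_mul_self]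

theorem blockRefl_submatrix {ι' : Type*} [Fintype ι'] [DecidableEq ι'] (e : ι' ≃ ι) :
    (blockRefl f a).submatrix e e = blockRefl (f ∘ e) (a ∘ e) := by
  ext i j
  have h : ∑ l with f (e l) = f (e i), a (e l) ^ 2 = ∑ l with f l = f (e i), a l ^ 2 := by
    rw [Finset.sum_filter, Finset.sum_filter]
    exact e.sum_comp fun l => if f l = f (e i) then a l ^ 2 else 0
  simp only [blockRefl, Matrix.submatrix_apply, Matrix.sub_apply, Matrix.of_apply,
    Matrix.one_apply, e.injective.eq_iff, Function.comp_apply, h]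

theorem blockRefl_comp_equiv {ι' : Type*} [Fintype ι'] [DecidableEq ι'] (e : ι' ≃ ι) (x : ι → ℂ) :
    blockRefl (f ∘ e) (a ∘ e) *ᵥ (x ∘ e) = (blockRefl f a *ᵥ x) ∘ e := by
  rw [← blockRefl_submatrix, Matrix.submatrix_mulVec_equiv]
  simp [Function.comp_assoc]

/-- The action of a block reflection at an index depends only on the part of the fibre where the
amplitudes do not vanish. -/
theorem blockRefl_mulVec_congr {a' : ι → ℝ} {x x' : ι → ℂ} {i : ι} (ha : a i = a' i)
    (hx : x i = x' i)
    (h : a i ≠ 0 → ∀ l, f l = f i → a l = a' l ∧ (a l : ℂ) * x l = (a' l : ℂ) * x' l) :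
    (blockRefl f a *ᵥ x) i = (blockRefl f a' *ᵥ x') i := by
  rw [blockRefl_mulVec_apply, blockRefl_mulVec_apply, hx, ← ha]
  by_cases h0 : a i = 0
  · simp [h0]
  · rw [Finset.sum_congr rfl fun l hl => by rw [(h h0 l (Finset.mem_filter.1 hl).2).1],
      Finset.sum_congr rfl fun l hl => (h h0 l (Finset.mem_filter.1 hl).2).2]

theorem blockRefl_zero : blockRefl f (fun _ => 0) = 1 := by
  ext i j
  simp [blockRefl]

/-- A block reflection that preserves the first coordinate of a product acts on slices. -/
theorem blockRefl_prod_mulVec {ρ : Type*} [Fintype ρ] [DecidableEq ρ] (f : ι → κ)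
    (a : ρ → ι → ℝ) (x : ρ × ι → ℂ) (r : ρ) (i : ι) :
    (blockRefl (fun p : ρ × ι => (p.1, f p.2)) (fun p => a p.1 p.2) *ᵥ x) (r, i)
      = (blockRefl f (a r) *ᵥ fun j => x (r, j)) i := by
  have h {M : Type} [AddCommMonoid M] (g : ρ × ι → M) :
      ∑ l with ((l.1, f l.2) : ρ × κ) = (r, f i), g l = ∑ l with f l = f i, g (r, l) := by
    rw [Finset.sum_filter, Finset.sum_filter, Fintype.sum_prod_type, Finset.sum_eq_single r]
    · simp
    · intro s _ hs
      simp [hs]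
    · simp
  simp only [blockRefl_mulVec_apply]
  rw [h fun l => a l.1 l.2 ^ 2, h fun l => (a l.1 l.2 : ℂ) * x l]

/-- The block reflection for the difference of two unit vectors exchanges them. -/
theorem blockRefl_sub_mulVec {p q : ι → ℝ} (hp : ∑ i, p i ^ 2 = 1) (hq : ∑ i, q i ^ 2 = 1) (c : ℂ) :
    blockRefl (fun _ => ()) (fun i => p i - q i) *ᵥ (fun i => (p i : ℂ) * c)
      = fun i => (q i : ℂ) * c := by
  ext i
  rw [blockRefl_mulVec_apply]
  simp only [Finset.filter_true]
  have h1 : ∑ l, (p l - q l) ^ 2 = 2 * (1 - ∑ l, p l * q l) := by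
    rw [show (2 : ℝ) * (1 - ∑ l, p l * q l) = (∑ l, p l ^ 2) + (∑ l, q l ^ 2) - 2 * ∑ l, p l * q l by
      rw [hp, hq]; ring, Finset.mul_sum, ← Finset.sum_add_distrib, ← Finset.sum_sub_distrib]
    exact Finset.sum_congr rfl fun l _ => by ring
  have h2 : ∑ l, ((p l - q l : ℝ) : ℂ) * ((p l : ℂ) * c) = ((1 - ∑ l, p l * q l : ℝ) : ℂ) * c := by
    rw [← hp, ← Finset.sum_sub_distrib, Complex.ofReal_sum, Finset.sum_mul]
    exact Finset.sum_congr rfl fun l _ => by push_cast; ring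
  rw [h1, h2]
  -- Unit vectors with inner product 1 coincide, and then the reflection is the identity.
  by_cases h : 1 - ∑ l, p l * q l = 0
  · have : ∑ l, (p l - q l) ^ 2 = 0 := by rw [h1, h, mul_zero]
    have := (Finset.sum_eq_zero_iff_of_nonneg fun l _ => sq_nonneg _).1 this i (Finset.mem_univ i)
    have : p i - q i = 0 := pow_eq_zero_iff (two_ne_zero) |>.1 this
    rw [h, this, sub_eq_zero.1 this]
    simp
  · have h' : ((1 - ∑ l, p l * q l : ℝ) : ℂ) ≠ 0 := by exact_mod_cast h
    rw [mul_div_mul_left _ _ two_ne_zero, Complex.ofReal_div, ← mul_assoc, div_mul_cancel₀ _ h']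
    push_cast
    ring

end BlockRefl

/-- Basis states where `a` vanishes are fixed and form singleton classes, so only the support of `a`
in each fibre has to be local. -/
theorem isCLocal_blockRefl {V κ : Type*} [Fintype V] [DecidableEq V] [DecidableEq κ] {m : ℕ}
    {G : SimpleGraph V} {f : Basis V m → κ} {a : Basis V m → ℝ}
    (h : ∀ b, a b ≠ 0 → (∃ v, ∀ b', a b' ≠ 0 → f b = f b' → b'.1 = v) ∨
      ∃ v w, G.Adj v w ∧ ∀ b', a b' ≠ 0 → f b = f b' → b'.1 = v ∨ b'.1 = w) :
    IsCLocal G (blockRefl f a) := by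
  refine ⟨⟨fun b b' => b = b' ∨ (a b ≠ 0 ∧ a b' ≠ 0 ∧ f b = f b'), fun b => Or.inl rfl, ?_, ?_⟩,
    ?_, ?_⟩
  · rintro b b' (rfl | ⟨h1, h2, h3⟩)
    · exact Or.inl rfl
    · exact Or.inr ⟨h2, h1, h3.symm⟩
  · rintro b b' b'' (rfl | ⟨h1, h2, h3⟩) (rfl | ⟨h1', h2', h3'⟩)
    · exact Or.inl rfl
    · exact Or.inr ⟨h1', h2', h3'⟩
    · exact Or.inr ⟨h1, h2, h3⟩
    · exact Or.inr ⟨h1, h2', h3.trans h3'⟩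
  · intro b b' hb
    have hb' : ¬(b = b' ∨ (a b ≠ 0 ∧ a b' ≠ 0 ∧ f b = f b')) := hb
    push Not at hb'
    rw [blockRefl, Matrix.sub_apply, Matrix.one_apply_ne (Ne.symm hb'.1), Matrix.of_apply]
    by_cases h1 : a b = 0
    · simp [h1]
    by_cases h2 : a b' = 0
    · simp [h2]
    · rw [if_neg (Ne.symm (hb'.2 h1 h2)), sub_zero]
  · intro b
    by_cases hb : a b = 0
    · refine Or.inl ⟨b.1, ?_⟩
      rintro b' (rfl | ⟨h1, -⟩)
      · rfl
      · exact absurd hb h1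
    · rcases h b hb with ⟨v, hv⟩ | ⟨v, w, hvw, hv⟩
      · refine Or.inl ⟨v, ?_⟩
        rintro b' (rfl | ⟨h1, h2, h3⟩)
        · exact hv _ hb rfl
        · exact hv _ h2 h3
      · refine Or.inr ⟨v, w, hvw, ?_⟩
        rintro b' (rfl | ⟨h1, h2, h3⟩)
        · exact hv _ hb rfl
        · exact hv _ h2 h3

/-! ### Registers of the robot and controlled reflections. -/

section Machine

variable {V K : Type*} {M : ℕ}

/-- The basis states of the walking robot: the oracle bit, the output bit and the clock, followed
by the location and the walk register. -/
abbrev Joint (V K : Type*) (M : ℕ) : Type _ := (Bool × Bool × Fin M) × (V × K)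

def jointOracle (X : V → Bool) (j : Joint V K M) : Joint V K M :=
  ((xor j.1.1 (X j.2.1), j.1.2), j.2)

/-- Embeds a state of the other registers as a state with oracle bit `0`. -/
def withBit (χ : Bool × Fin M → V × K → ℂ) (j : Joint V K M) : ℂ :=
  if j.1.1 = false then χ j.1.2 j.2 else 0

/-- Bits 0 and 1 serve as oracle bit and output bit; the other `s + t` bits encode clock and walk
register, whence the powers of two. -/
theorem exists_joint_equiv [Fintype V] [Fintype K] {s t : ℕ} (hK : Fintype.card K = 2 ^ t)
    (k₀ : K) :
    ∃ (m : ℕ) (e : Basis V (m + 1) ≃ Joint V K (2 ^ s)),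
      (∀ b, (e b).2.1 = b.1) ∧ (∀ b, (e b).1.2.1 = b.2 1) ∧
      (∀ v, e (v, fun _ => false) = ((false, false, 0), (v, k₀))) ∧
      ∀ (X : V → Bool) b, e (oracleMap X b) = jointOracle X (e b) := by
  classical
  have hc : Fintype.card (Fin (s + t) → Bool) = Fintype.card (Fin (2 ^ s) × K) := by
    simp [hK, pow_add]
  set g₀ := Fintype.equivOfCardEq hc
  -- The swap makes the all-zero string encode clock 0 and the prescribed initial walk state.
  set g : (Fin (s + t) → Bool) ≃ Fin (2 ^ s) × K :=
    g₀.trans (Equiv.swap (g₀ fun _ => false) (0, k₀))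
  have hg : g (fun _ => false) = (0, k₀) := by simp [g]
  refine ⟨s + t, ⟨fun b => ((b.2 0, b.2 1, (g fun i => b.2 i.succ.succ).1),
      (b.1, (g fun i => b.2 i.succ.succ).2)),
    fun j => (j.2.1, Fin.cons j.1.1 (Fin.cons j.1.2.1 (g.symm (j.1.2.2, j.2.2)))), ?_, ?_⟩,
    fun b => rfl, fun b => rfl, fun v => ?_, fun X b => ?_⟩
  · rintro ⟨v, z⟩
    refine Prod.ext rfl (funext fun i => ?_)
    refine Fin.cases ?_ (fun i => Fin.cases ?_ (fun i => ?_) i) i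
    · rfl
    · rfl
    · simp
  · rintro ⟨⟨z, o, c⟩, v, k⟩
    have h1 : (Fin.cons z (Fin.cons o (g.symm (c, k)) : Fin (s + t + 1) → Bool) :
        Fin (s + t + 2) → Bool) 1 = o := rfl
    simp [h1]
  · simp [hg]
  · have h1 : ∀ i : Fin (s + t), i.succ.succ ≠ (0 : Fin (s + t + 2)) := fun i => Fin.succ_ne_zero _
    simp [oracleMap, jointOracle, h1]

variable [Fintype V] [DecidableEq V] [Fintype K] [DecidableEq K]

/-- A reflection of the output bit and the clock, the other registers being fixed. -/
noncomputable def coinRefl (c : Bool × Fin M → ℝ) : Matrix (Joint V K M) (Joint V K M) ℂ :=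
  blockRefl (fun j => ((j.1.1, j.2), ())) fun j => c j.1.2

/-- A block reflection of the walk, controlled by the oracle bit and the clock. -/
noncomputable def ctrlRefl {N : Type*} [DecidableEq N] (f : V × K → N)
    (a : Bool × Bool × Fin M → V × K → ℝ) : Matrix (Joint V K M) (Joint V K M) ℂ :=
  blockRefl (fun j => (j.1, f j.2)) fun j => a j.1 j.2

theorem coinRefl_mulVec_withBit (c : Bool × Fin M → ℝ) (χ : Bool × Fin M → V × K → ℂ) :
    coinRefl c *ᵥ withBit χ
      = withBit fun p i => (blockRefl (fun _ => ()) c *ᵥ fun p' => χ p' i) p := by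
  set e : Joint V K M ≃ (Bool × (V × K)) × (Bool × Fin M) :=
    ⟨fun j => ((j.1.1, j.2), j.1.2), fun j => ((j.1.1, j.2), j.1.2), fun _ => rfl, fun _ => rfl⟩
  have h := blockRefl_comp_equiv (f := fun p : (Bool × (V × K)) × (Bool × Fin M) => (p.1, ()))
    (a := fun p => c p.2) e (withBit χ ∘ e.symm)
  rw [Function.comp_assoc, e.symm_comp_self, Function.comp_id] at h
  refine h.trans (funext fun j => ?_)
  refine (blockRefl_prod_mulVec (fun _ => ()) (fun _ => c) (withBit χ ∘ e.symm) (j.1.1, j.2)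
    j.1.2).trans ?_
  by_cases hj : j.1.1 = false
  · simp only [withBit, hj, if_true]
    congr 2
  · have h0 : (fun p => (withBit χ ∘ e.symm) ((j.1.1, j.2), p)) = 0 := by
      ext p
      simp only [Function.comp_apply, withBit, Pi.zero_apply]
      exact if_neg hj
    rw [h0, Matrix.mulVec_zero, withBit, if_neg hj, Pi.zero_apply]

theorem ctrlRefl_mulVec_withBit {N : Type*} [DecidableEq N] (f : V × K → N)
    (a : Bool × Fin M → V × K → ℝ) (χ : Bool × Fin M → V × K → ℂ) :
    ctrlRefl f (fun r => a r.2) *ᵥ withBit χ = withBit fun p => blockRefl f (a p) *ᵥ χ p := by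
  ext j
  refine (blockRefl_prod_mulVec f (fun r : Bool × Bool × Fin M => a r.2) (withBit χ)
    j.1 j.2).trans ?_
  by_cases hj : j.1.1 = false
  · simp [withBit, hj]
  · have h0 : (fun i => withBit χ (j.1, i)) = 0 := by
      ext i
      exact if_neg hj
    rw [h0, Matrix.mulVec_zero, withBit, if_neg hj, Pi.zero_apply]

/-- A controlled reflection conjugated with the oracle, when the reflection mixes only states at
the same location: the control by the oracle bit becomes a control by the input. -/
theorem oracle_conj_ctrlRefl {N : Type*} [DecidableEq N] (X : V → Bool) (f : V × K → N)
    (a : Bool → Bool × Fin M → V × K → ℝ)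
    (ha : ∀ y y' p i i', a y p i ≠ 0 → a y' p i' ≠ 0 → f i = f i' → i.1 = i'.1)
    (χ : Bool × Fin M → V × K → ℂ) :
    (ctrlRefl f (fun r => a r.1 r.2) *ᵥ (withBit χ ∘ jointOracle X)) ∘ jointOracle X
      = withBit fun p => blockRefl f (fun i => a (X i.1) p i) *ᵥ χ p := by
  ext j
  obtain ⟨⟨z, p⟩, i⟩ := j
  have h1 : jointOracle X ((z, p), i) = ((xor z (X i.1), p), i) := rfl
  rw [Function.comp_apply, h1]
  refine (blockRefl_prod_mulVec f (fun r : Bool × Bool × Fin M => a r.1 r.2)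
    (withBit χ ∘ jointOracle X) (xor z (X i.1), p) i).trans ?_
  rcases z with _ | _
  · rw [withBit, if_pos rfl]
    refine blockRefl_mulVec_congr ?_ ?_ ?_
    · simp
    · simp [withBit, jointOracle]
    · intro hi l hl
      simp only [Bool.false_bne, withBit, jointOracle, Function.comp_apply] at *
      -- By `ha`, fibre members at other vertices have amplitude 0, so the oracle bit agrees with
      -- the same input value on the effective fibre.
      by_cases h : l.1 = i.1
      · simp [h]
      · have h2 : ∀ y, a y p l = 0 := by
          intro y
          by_contra h3
          exact h (ha _ _ _ _ _ hi h3 hl.symm).symm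
        simp [h2]
  -- In this branch the oracle bit disagrees with the input at the vertex, so the state vanishes on
  -- the effective fibre and can be replaced by 0.
  · rw [withBit, if_neg (by simp)]
    rw [show (0 : ℂ) = (blockRefl f (a (xor true (X i.1)) p) *ᵥ (0 : V × K → ℂ)) i by
      rw [Matrix.mulVec_zero]; rfl]
    refine blockRefl_mulVec_congr rfl ?_ ?_
    · simp [withBit, jointOracle]
    · intro hi l hl
      refine ⟨rfl, ?_⟩
      by_cases h : l.1 = i.1
      · simp [withBit, jointOracle, h]
      · have h2 : ∀ y, a y p l = 0 := by
          intro y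
          by_contra h3
          exact h (ha _ _ _ _ _ hi h3 hl.symm).symm
        simp [h2]

theorem isCLocal_coinRefl {G : SimpleGraph V} {m : ℕ} (e : Basis V m ≃ Joint V K M)
    (he : ∀ b, (e b).2.1 = b.1) (c : Bool × Fin M → ℝ) :
    IsCLocal G ((coinRefl c).submatrix e e) := by
  rw [coinRefl, blockRefl_submatrix]
  refine isCLocal_blockRefl fun b _ => Or.inl ⟨b.1, fun b' _ h => ?_⟩
  rw [← he, ← he]
  simp only [Function.comp_apply, Prod.mk.injEq] at h
  rw [h.1.2]

theorem isCLocal_ctrlRefl {G : SimpleGraph V} {m : ℕ} (e : Basis V m ≃ Joint V K M)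
    (he : ∀ b, (e b).2.1 = b.1) {N : Type*} [DecidableEq N] (f : V × K → N)
    (a : Bool × Bool × Fin M → V × K → ℝ)
    (h : ∀ r i, a r i ≠ 0 → (∃ v, ∀ i', a r i' ≠ 0 → f i = f i' → i'.1 = v) ∨
      ∃ v w, G.Adj v w ∧ ∀ i', a r i' ≠ 0 → f i = f i' → i'.1 = v ∨ i'.1 = w) :
    IsCLocal G ((ctrlRefl f a).submatrix e e) := by
  rw [ctrlRefl, blockRefl_submatrix]
  refine isCLocal_blockRefl fun b hb => ?_
  rcases h (e b).1 (e b).2 hb with ⟨v, hv⟩ | ⟨v, w, hvw, hv⟩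
  · refine Or.inl ⟨v, fun b' hb' hf => ?_⟩
    simp only [Function.comp_apply, Prod.mk.injEq] at hf hb'
    rw [← he]
    exact hv _ (hf.1 ▸ hb') hf.2
  · refine Or.inr ⟨v, w, hvw, fun b' hb' hf => ?_⟩
    simp only [Function.comp_apply, Prod.mk.injEq] at hf hb'
    rw [← he]
    exact hv _ (hf.1 ▸ hb') hf.2

end Machine

/-! ### Conservation of probability. -/

theorem sum_norm_sq_mulVec_unitary {ι : Type*} [Fintype ι] [DecidableEq ι] {U : Matrix ι ι ℂ}
    (hU : U ∈ Matrix.unitaryGroup ι ℂ) (x : ι → ℂ) :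
    ∑ i, ‖(U *ᵥ x) i‖ ^ 2 = ∑ i, ‖x i‖ ^ 2 := by
  have h (y : ι → ℂ) : ((∑ i, ‖y i‖ ^ 2 : ℝ) : ℂ) = star y ⬝ᵥ y := by
    rw [dotProduct]
    push_cast
    exact Finset.sum_congr rfl fun i _ => (Complex.conj_mul' (y i)).symm
  have : ((∑ i, ‖(U *ᵥ x) i‖ ^ 2 : ℝ) : ℂ) = ((∑ i, ‖x i‖ ^ 2 : ℝ) : ℂ) := by
    rw [h, h, Matrix.star_mulVec, Matrix.dotProduct_mulVec, Matrix.vecMul_vecMul,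
      ← Matrix.star_eq_conjTranspose, Matrix.mem_unitaryGroup_iff'.1 hU, Matrix.vecMul_one]
  exact_mod_cast this

theorem Robot.sum_norm_sq_state {V : Type*} [Fintype V] [DecidableEq V] {G : SimpleGraph V}
    (A : Robot G) (v₁ : V) (X : V → Bool) (t : ℕ) : ∑ b, ‖A.state v₁ X t b‖ ^ 2 = 1 := by
  induction t with
  | zero =>
    rw [Robot.state, Finset.sum_eq_single (v₁, fun _ => false)]
    · simp
    · intro b _ hb
      simp [hb]
    · simp
  | succ t ih =>
    rw [← ih, ← sum_norm_sq_mulVec_unitary (A.step_unitary t) (A.state v₁ X t)]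
    exact Equiv.sum_comp (oracleMap_involutive X).toPerm
      fun b => ‖((A.step t).mulVec (A.state v₁ X t)) b‖ ^ 2

theorem Robot.prob_false {V : Type*} [Fintype V] [DecidableEq V] {G : SimpleGraph V}
    (A : Robot G) (v₁ : V) (T : ℕ) (X : V → Bool) :
    A.prob v₁ T X false = 1 - A.prob v₁ T X true := by
  rw [eq_sub_iff_add_eq, ← A.sum_norm_sq_state v₁ X T, Robot.prob, Robot.prob,
    ← Finset.sum_filter_add_sum_filter_not Finset.univ fun b : Basis V A.mem => b.2 A.out = false]
  simp

/-! ### The phase detection circuit. -/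

section Iteration

variable {V K N N' : Type*} [Fintype V] [DecidableEq V] [Fintype K] [DecidableEq K]
  [DecidableEq N] [DecidableEq N']

/-- The amplitudes of the stars of the walk on input `X`: tested marked states are removed. -/
def starAmp (a : V × K → ℝ) (test : V × K → Bool) (X : V → Bool) (i : V × K) : ℝ :=
  if X i.1 && test i then 0 else a i

/-- One step of the quantum walk on input `X`. -/
noncomputable def walkMatrix (f : V × K → N) (a : V × K → ℝ) (test : V × K → Bool) (g : V × K → N')
    (b : V × K → ℝ) (X : V → Bool) : Matrix (V × K) (V × K) ℂ :=
  blockRefl f (starAmp a test X) * blockRefl g b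

/-- The Cesàro mean of the first `M` states of the walk started at `i₀`. -/
noncomputable def cesaro {I : Type*} [Fintype I] [DecidableEq I] (U : Matrix I I ℂ) (i₀ : I)
    (M : ℕ) (i : I) : ℂ :=
  (M : ℂ)⁻¹ * ∑ m ∈ Finset.range M, (U ^ m *ᵥ Pi.single i₀ 1) i

variable {M : ℕ}

noncomputable def uniformAmp (M : ℕ) (y : Bool) (p : Bool × Fin M) : ℝ :=
  if p.1 = y then (√M)⁻¹ else 0

theorem sum_uniformAmp_sq (hM : M ≠ 0) (y : Bool) : ∑ p, uniformAmp M y p ^ 2 = 1 := by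
  have hM' : (M : ℝ) ≠ 0 := by exact_mod_cast hM
  rw [Fintype.sum_prod_type, Fintype.sum_eq_single y]
  · simp [uniformAmp, hM']
  · intro z hz
    simp [uniformAmp, hz]

theorem sum_single_sq {ι : Type*} [Fintype ι] [DecidableEq ι] (p : ι) :
    ∑ q, (Pi.single p 1 : ι → ℝ) q ^ 2 = 1 := by
  rw [Finset.sum_eq_single p]
  · simp
  · intro q _ hq
    simp [hq]
  · simp

/-- The operators of the phase detection algorithm before the even-numbered oracle calls: the
preparation of the clock, the edge reflections of the walk (controlled by the clock), and the test
for the uniform state of the clock. -/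
noncomputable def phaseEven [NeZero M] (g : V × K → N') (b : V × K → ℝ) (q : ℕ) :
    Matrix (Joint V K M) (Joint V K M) ℂ :=
  if q = 0 then coinRefl fun p => (Pi.single (false, 0) 1 : Bool × Fin M → ℝ) p - uniformAmp M false p
  else if q < M then ctrlRefl g fun r i => if q ≤ (r.2.2 : ℕ) then b i else 0
  else coinRefl fun p => uniformAmp M false p - (Pi.single (true, 0) 1 : Bool × Fin M → ℝ) p

/-- The operators of the phase detection algorithm before the odd-numbered oracle calls: the
star reflections of the walk, controlled by the clock and the oracle bit. -/
noncomputable def phaseOdd (f : V × K → N) (a : V × K → ℝ) (test : V × K → Bool) (q : ℕ) :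
    Matrix (Joint V K M) (Joint V K M) ℂ :=
  ctrlRefl f fun r i =>
    -- Round 0 only prepares the clock; its two oracle calls cancel.
    if q ≠ 0 ∧ q ≤ (r.2.2 : ℕ) then (if r.1 && test i then 0 else a i) else 0

noncomputable def phaseStep [NeZero M] (f : V × K → N) (a : V × K → ℝ) (test : V × K → Bool)
    (g : V × K → N') (b : V × K → ℝ) (t : ℕ) : Matrix (Joint V K M) (Joint V K M) ℂ :=
  if t % 2 = 0 then phaseEven g b (t / 2) else phaseOdd f a test (t / 2)

noncomputable def phaseState [NeZero M] (f : V × K → N) (a : V × K → ℝ) (test : V × K → Bool)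
    (g : V × K → N') (b : V × K → ℝ) (i₀ : V × K) (X : V → Bool) : ℕ → Joint V K M → ℂ
  | 0 => Pi.single ((false, false, 0), i₀) 1
  | t + 1 => (phaseStep f a test g b t *ᵥ phaseState f a test g b i₀ X t) ∘ jointOracle X

variable [NeZero M] {f : V × K → N} {a : V × K → ℝ} {test : V × K → Bool}
    {g : V × K → N'} {b : V × K → ℝ} {i₀ : V × K} {X : V → Bool}

/-- The two oracle calls of a round conjugate the star reflection: the first writes the input bit
that controls it, the second erases this bit again. -/
theorem phaseState_two_mul_succ (q : ℕ) (χ χ' : Bool × Fin M → V × K → ℂ)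
    (hf : ∀ i i', a i ≠ 0 → a i' ≠ 0 → f i = f i' → i.1 = i'.1)
    (h0 : phaseState f a test g b i₀ X (2 * q) = withBit χ)
    (h1 : phaseEven g b q *ᵥ withBit χ = withBit χ') :
    phaseState f a test g b i₀ X (2 * (q + 1)) = withBit fun p =>
      if q ≠ 0 ∧ q ≤ (p.2 : ℕ) then blockRefl f (starAmp a test X) *ᵥ χ' p else χ' p := by
  have e1 : 2 * q % 2 = 0 := by omega
  have e2 : 2 * q / 2 = q := by omega
  have e3 : ¬ (2 * q + 1) % 2 = 0 := by omega
  have e4 : (2 * q + 1) / 2 = q := by omega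
  rw [show 2 * (q + 1) = 2 * q + 1 + 1 by ring, phaseState, phaseState, h0, phaseStep, phaseStep,
    if_pos e1, if_neg e3, e2, e4, h1, phaseOdd,
    oracle_conj_ctrlRefl X f fun y p i =>
      if q ≠ 0 ∧ q ≤ (p.2 : ℕ) then (if y && test i then 0 else a i) else 0]
  · congr 1
    ext p : 1
    split_ifs with h
    · rfl
    · rw [blockRefl_zero, Matrix.one_mulVec]
  · intro y y' p i i' h h' hi
    refine hf i i' ?_ ?_ hi
    · rintro h2
      simp [h2] at h
    · rintro h2
      simp [h2] at h'

/-- The branch with clock value c takes part in rounds 1, …, c only, which explains the exponent. -/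
theorem phaseState_of_lt (hf : ∀ i i', a i ≠ 0 → a i' ≠ 0 → f i = f i' → i.1 = i'.1)
    (q : ℕ) (hq : q < M) :
    phaseState f a test g b i₀ X (2 * (q + 1)) = withBit fun (p : Bool × Fin M) i =>
      ((uniformAmp M false p : ℝ) : ℂ) *
        (walkMatrix f a test g b X ^ (min q p.2) *ᵥ Pi.single i₀ 1) i := by
  induction q with
  | zero =>
    rw [phaseState_two_mul_succ 0
      (fun p i => (((Pi.single (false, 0) 1 : Bool × Fin M → ℝ) p : ℝ) : ℂ) *
        (Pi.single i₀ 1 : V × K → ℂ) i)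
      (fun p i => ((uniformAmp M false p : ℝ) : ℂ) * (Pi.single i₀ 1 : V × K → ℂ) i) hf]
    · simp only [ne_eq, not_true_eq_false, false_and, if_false, Nat.zero_min, pow_zero,
        Matrix.one_mulVec]
    · ext ⟨⟨z, p⟩, i⟩
      simp only [phaseState, withBit, Pi.single_apply, Prod.mk.injEq]
      by_cases h1 : z = false <;> by_cases h2 : p = (false, 0) <;> by_cases h3 : i = i₀ <;>
        simp [h1, h2, h3]
    · rw [phaseEven, if_pos rfl, coinRefl_mulVec_withBit]
      congr 1
      ext p i
      rw [blockRefl_sub_mulVec (sum_single_sq _) (sum_uniformAmp_sq (NeZero.ne M) _)]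
  | succ q ih =>
    rw [phaseState_two_mul_succ (q + 1) _ (χ' := fun p =>
      if q + 1 ≤ (p.2 : ℕ) then blockRefl g b *ᵥ (fun i => ((uniformAmp M false p : ℝ) : ℂ) *
        (walkMatrix f a test g b X ^ (min q p.2) *ᵥ Pi.single i₀ 1) i)
      else (fun i => ((uniformAmp M false p : ℝ) : ℂ) *
        (walkMatrix f a test g b X ^ (min q p.2) *ᵥ Pi.single i₀ 1) i)) hf (ih (by omega))]
    · congr 1
      ext p : 1
      by_cases h : q + 1 ≤ (p.2 : ℕ)
      · rw [if_pos h, if_pos ⟨by omega, h⟩, min_eq_left h, min_eq_left (by omega : q ≤ (p.2 : ℕ)),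
          pow_succ', ← Matrix.mulVec_mulVec]
        refine (Matrix.mulVec_mulVec _ _ _).trans ?_
        exact Matrix.mulVec_smul (walkMatrix f a test g b X) ((uniformAmp M false p : ℝ) : ℂ)
          (walkMatrix f a test g b X ^ q *ᵥ Pi.single i₀ 1)
      · rw [if_neg h, if_neg (by tauto), min_eq_right (by omega : (p.2 : ℕ) ≤ q + 1),
          min_eq_right (by omega : (p.2 : ℕ) ≤ q)]
    · rw [phaseEven, if_neg (by omega), if_pos hq]
      refine (ctrlRefl_mulVec_withBit g
        (fun (p : Bool × Fin M) i => if q + 1 ≤ (p.2 : ℕ) then b i else 0) _).trans ?_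
      congr 1
      ext p : 1
      split_ifs with h
      · rfl
      · rw [blockRefl_zero, Matrix.one_mulVec]

/-- The last reflection exchanges the uniform clock state with the flagged state `(true, 0)`, so the
flagged amplitude is the overlap with the uniform state, which is the mean of the iterates. -/
theorem phaseState_final (hf : ∀ i i', a i ≠ 0 → a i' ≠ 0 → f i = f i' → i.1 = i'.1)
    (j : Joint V K M) (hj : j.1.2.1 = true) :
    phaseState f a test g b i₀ X (2 * (M + 1)) j =
      if j.1.1 = false ∧ j.1.2.2 = 0 then cesaro (walkMatrix f a test g b X) i₀ M j.2 else 0 := by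
  obtain ⟨q, hq⟩ := Nat.exists_eq_succ_of_ne_zero (NeZero.ne M)
  have h := phaseState_of_lt (f := f) (a := a) (test := test) (g := g) (b := b) (i₀ := i₀) (X := X)
    hf q (by omega : q < M)
  rw [show q + 1 = M by omega] at h
  rw [phaseState_two_mul_succ M _ _ hf h (by
    rw [phaseEven, if_neg (NeZero.ne M), if_neg (lt_irrefl _), coinRefl_mulVec_withBit]), withBit]
  by_cases h0 : j.1.1 = false
  swap
  · simp [h0]
  -- In round `M` the star reflection is idle, because clock values are below `M`.
  have h2 : ¬ (M ≠ 0 ∧ M ≤ (j.1.2.2 : ℕ)) := fun h => absurd h.2 (not_le.2 j.1.2.2.2)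
  rw [if_pos h0, if_neg h2, blockRefl_mulVec_apply]
  obtain ⟨⟨z, o, c⟩, i⟩ := j
  simp only at hj h0
  subst hj h0
  have hM' : (M : ℝ) ≠ 0 := by exact_mod_cast NeZero.ne M
  have h3 : ∑ p : Bool × Fin M, (uniformAmp M false p - (Pi.single (true, 0) 1 : Bool × Fin M → ℝ) p) ^ 2
      = 2 := by
    rw [Fintype.sum_prod_type, Fintype.sum_bool]
    simp [uniformAmp, Pi.single_apply, hM']
    norm_num
  have h4 (x : ℕ → ℂ) : ∑ p : Bool × Fin M,
      ((uniformAmp M false p - (Pi.single (true, 0) 1 : Bool × Fin M → ℝ) p : ℝ) : ℂ) *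
        (((uniformAmp M false p : ℝ) : ℂ) * x p.2) = (M : ℂ)⁻¹ * ∑ m ∈ Finset.range M, x m := by
    rw [Fintype.sum_prod_type, Fintype.sum_bool, Finset.mul_sum, Finset.sum_range]
    have : (((√M)⁻¹ : ℝ) : ℂ) * (((√M)⁻¹ : ℝ) : ℂ) = (M : ℂ)⁻¹ := by
      rw [← Complex.ofReal_mul, ← mul_inv, Real.mul_self_sqrt (Nat.cast_nonneg M)]
      push_cast
      rfl
    simp [uniformAmp, ← mul_assoc, ← this]
  simp only [Finset.filter_true]
  rw [h3]
  have h5 : ∀ p : Bool × Fin M, min q (p.2 : ℕ) = p.2 := fun p => min_eq_right (by omega)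
  simp only [h5]
  rw [h4 fun m => (walkMatrix f a test g b X ^ m *ᵥ Pi.single i₀ 1) i]
  by_cases hc : c = 0
  · simp [uniformAmp, hc, cesaro]
  · simp [uniformAmp, hc]

/-- Phase detection for the quantum walk can be carried out by a robot. -/
theorem exists_robot_phase_detection (G : SimpleGraph V) {t : ℕ} (hK : Fintype.card K = 2 ^ t)
    (s : ℕ) (hf : ∀ i i', a i ≠ 0 → a i' ≠ 0 → f i = f i' → i.1 = i'.1)
    (hg : ∀ i, b i ≠ 0 → (∃ v, ∀ i', b i' ≠ 0 → g i = g i' → i'.1 = v) ∨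
      ∃ v w, G.Adj v w ∧ ∀ i', b i' ≠ 0 → g i = g i' → i'.1 = v ∨ i'.1 = w) :
    ∃ A : Robot G, ∀ X, A.prob i₀.1 (2 * (2 ^ s + 1)) X true =
      ∑ i, ‖cesaro (walkMatrix f a test g b X) i₀ (2 ^ s) i‖ ^ 2 := by
  obtain ⟨m, e, he1, he2, he3, he4⟩ := exists_joint_equiv (V := V) (s := s) hK i₀.2
  have hunit (M : Matrix (Joint V K (2 ^ s)) (Joint V K (2 ^ s)) ℂ)
      (h : M ∈ Matrix.unitaryGroup _ ℂ) : M.submatrix e e ∈ Matrix.unitaryGroup _ ℂ := by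
    rw [Matrix.mem_unitaryGroup_iff, Matrix.star_eq_conjTranspose, Matrix.conjTranspose_submatrix,
      Matrix.submatrix_mul_equiv, ← Matrix.star_eq_conjTranspose, Matrix.mem_unitaryGroup_iff.1 h,
      Matrix.submatrix_one_equiv]
  let A : Robot G :=
    { mem := m + 1
      step := fun t => (phaseStep f a test g b t).submatrix e e
      step_unitary := fun t => by
        refine hunit _ ?_
        unfold phaseStep phaseEven phaseOdd
        split_ifs <;> exact blockRefl_mem_unitaryGroup
      step_local := fun t => by
        unfold phaseStep phaseEven
        split_ifs with h1 h2 h3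
        · exact isCLocal_coinRefl e he1 _
        · refine isCLocal_ctrlRefl e he1 _ _ fun r i hi => ?_
          have hb : ∀ i, (if t / 2 ≤ (r.2.2 : ℕ) then b i else 0) ≠ 0 → b i ≠ 0 := by
            intro i h h'
            simp [h'] at h
          rcases hg i (hb i hi) with ⟨v, hv⟩ | ⟨v, w, hvw, hv⟩
          · exact Or.inl ⟨v, fun i' hi' => hv i' (hb i' hi')⟩
          · exact Or.inr ⟨v, w, hvw, fun i' hi' => hv i' (hb i' hi')⟩
        · exact isCLocal_coinRefl e he1 _
        · refine isCLocal_ctrlRefl e he1 _ _ fun r i hi => Or.inl ⟨i.1, fun i' hi' hii => ?_⟩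
          refine (hf i i' ?_ ?_ hii).symm
          · rintro h
            simp [h] at hi
          · rintro h
            simp [h] at hi'
      out := 1 }
  refine ⟨A, fun X => ?_⟩
  have hstate : ∀ t, A.state i₀.1 X t = phaseState f a test g b i₀ X t ∘ e := by
    intro t
    induction t with
    | zero =>
      funext x
      have : e (i₀.1, fun _ => false) = ((false, false, 0), i₀) := he3 i₀.1
      rw [Robot.state, phaseState, Function.comp_apply, ← this, Pi.single_apply, Pi.single_apply]
      exact if_congr e.injective.eq_iff.symm rfl rfl
    | succ t ih =>
      have h : (A.step t).mulVec (A.state i₀.1 X t)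
          = (phaseStep f a test g b t *ᵥ phaseState f a test g b i₀ X t) ∘ e := by
        rw [ih]
        refine (Matrix.submatrix_mulVec_equiv _ _ _ _).trans ?_
        rw [Function.comp_assoc, e.self_comp_symm, Function.comp_id]
      funext x
      rw [Robot.state, h, phaseState, oracleStep, Function.comp_apply, Function.comp_apply,
        Function.comp_apply, he4]
  rw [Robot.prob, hstate, Finset.sum_filter]
  have h1 (x : Basis V A.mem) : x.2 A.out = (e x).1.2.1 := (he2 x).symm
  simp only [h1, Function.comp_apply]
  refine (e.sum_comp fun j => if j.1.2.1 = true then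
    ‖phaseState f a test g b i₀ X (2 * (2 ^ s + 1)) j‖ ^ 2 else 0).trans ?_
  have h2 (j : Joint V K (2 ^ s)) : (if j.1.2.1 = true then
      ‖phaseState f a test g b i₀ X (2 * (2 ^ s + 1)) j‖ ^ 2 else 0) =
      if j.1 = (false, true, 0) then
        ‖cesaro (walkMatrix f a test g b X) i₀ (2 ^ s) j.2‖ ^ 2 else 0 := by
    by_cases h : j.1.2.1 = true
    · rw [if_pos h, phaseState_final hf j h]
      by_cases h' : j.1.1 = false ∧ j.1.2.2 = 0
      · rw [if_pos h', if_pos (Prod.ext h'.1 (Prod.ext h h'.2))]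
      · rw [if_neg h', if_neg fun h'' => h' (by simp [h''])]
        simp
    · rw [if_neg h, if_neg fun h'' => h (by simp [h''])]
  simp only [h2]
  rw [Fintype.sum_prod_type, Fintype.sum_eq_single (false, true, 0)]
  · simp
  · intro x hx
    simp [hx]

end Iteration

/-! ### Bounds for the mean of the iterates. -/

section Cesaro

variable {I : Type*} [Fintype I] [DecidableEq I] {U : Matrix I I ℂ} {i₀ : I} {M : ℕ}

/-- If `e_{i₀}` is a coboundary of a short vector, then the Cesàro mean is small. -/
theorem sum_norm_sq_cesaro_le (hU : U ∈ Matrix.unitaryGroup I ℂ) {w : I → ℂ}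
    (hw : U *ᵥ w = w + (2 : ℂ) • Pi.single i₀ 1) :
    ∑ i, ‖cesaro U i₀ M i‖ ^ 2 ≤ (∑ i, ‖w i‖ ^ 2) / (M : ℝ) ^ 2 := by
  -- Telescoping: the orbit sum of the initial state is half of `U ^ m w - w`.
  have h1 : ∀ m : ℕ, U ^ m *ᵥ w
      = w + (2 : ℂ) • ∑ j ∈ Finset.range m, U ^ j *ᵥ Pi.single i₀ 1 := by
    intro m
    induction m with
    | zero => simp
    | succ m ih =>
      rw [pow_succ, ← Matrix.mulVec_mulVec, hw, Matrix.mulVec_add, ih, Matrix.mulVec_smul,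
        Finset.sum_range_succ, smul_add, add_assoc]
  have h2 (i : I) : ‖cesaro U i₀ M i‖ ^ 2
      ≤ (‖(U ^ M *ᵥ w) i‖ ^ 2 + ‖w i‖ ^ 2) / (2 * (M : ℝ) ^ 2) := by
    have h3 : cesaro U i₀ M i = (2 * (M : ℂ))⁻¹ * ((U ^ M *ᵥ w) i - w i) := by
      rw [h1, cesaro, Pi.add_apply, Pi.smul_apply, Finset.sum_apply, smul_eq_mul, mul_inv]
      ring
    have h4 : ‖(U ^ M *ᵥ w) i - w i‖ ≤ ‖(U ^ M *ᵥ w) i‖ + ‖w i‖ := norm_sub_le _ _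
    rw [h3, norm_mul, mul_pow, norm_inv, norm_mul, Complex.norm_ofNat, Complex.norm_natCast,
      show (‖(U ^ M *ᵥ w) i‖ ^ 2 + ‖w i‖ ^ 2) / (2 * (M : ℝ) ^ 2)
        = ((2 * (M : ℝ))⁻¹) ^ 2 * (2 * (‖(U ^ M *ᵥ w) i‖ ^ 2 + ‖w i‖ ^ 2)) by ring]
    refine mul_le_mul_of_nonneg_left ?_ (sq_nonneg _)
    nlinarith [sq_nonneg (‖(U ^ M *ᵥ w) i‖ - ‖w i‖), norm_nonneg ((U ^ M *ᵥ w) i - w i)]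
  calc _ ≤ ∑ i, (‖(U ^ M *ᵥ w) i‖ ^ 2 + ‖w i‖ ^ 2) / (2 * (M : ℝ) ^ 2) :=
        Finset.sum_le_sum fun i _ => h2 i
    _ = _ := by
      rw [← Finset.sum_div, Finset.sum_add_distrib, sum_norm_sq_mulVec_unitary (pow_mem hU M) w,
        ← two_mul, mul_div_mul_left _ _ two_ne_zero]

/-- The Cesàro mean has the same overlap with every invariant vector as the initial state. -/
theorem sq_le_mul_sum_norm_sq_cesaro {φ : I → ℝ} (hM : M ≠ 0)
    (hφ : (fun i => (φ i : ℂ)) ᵥ* U = fun i => (φ i : ℂ)) :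
    φ i₀ ^ 2 ≤ (∑ i, φ i ^ 2) * ∑ i, ‖cesaro U i₀ M i‖ ^ 2 := by
  have h1 : ∀ m : ℕ, (fun i => (φ i : ℂ)) ᵥ* (U ^ m) = fun i => (φ i : ℂ) := by
    intro m
    induction m with
    | zero => simp
    | succ m ih => rw [pow_succ, ← Matrix.vecMul_vecMul, ih, hφ]
  have h2 : ∑ i, (φ i : ℂ) * cesaro U i₀ M i = φ i₀ := by
    have h3 (m : ℕ) : ∑ i, (φ i : ℂ) * (U ^ m *ᵥ Pi.single i₀ 1) i = φ i₀ := by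
      have := Matrix.dotProduct_mulVec (fun i => (φ i : ℂ)) (U ^ m) (Pi.single i₀ 1)
      rw [h1] at this
      rwa [dotProduct_single, mul_one] at this
    have h4 (i : I) : (φ i : ℂ) * cesaro U i₀ M i = (M : ℂ)⁻¹ *
        ∑ m ∈ Finset.range M, (φ i : ℂ) * (U ^ m *ᵥ Pi.single i₀ 1) i := by
      rw [cesaro, mul_left_comm, Finset.mul_sum]
    simp only [h4]
    rw [← Finset.mul_sum, Finset.sum_comm]
    simp only [h3]
    simp [hM]
  have h4 : |φ i₀| ≤ ∑ i, |φ i| * ‖cesaro U i₀ M i‖ := by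
    rw [← Real.norm_eq_abs, ← Complex.norm_real, ← h2]
    refine (norm_sum_le _ _).trans (le_of_eq ?_)
    simp
  calc φ i₀ ^ 2 = |φ i₀| ^ 2 := (sq_abs _).symm
    _ ≤ (∑ i, |φ i| * ‖cesaro U i₀ M i‖) ^ 2 := pow_le_pow_left₀ (abs_nonneg _) h4 2
    _ ≤ (∑ i, |φ i| ^ 2) * ∑ i, ‖cesaro U i₀ M i‖ ^ 2 := Finset.sum_mul_sq_le_sq_mul_sq _ _ _
    _ = _ := by simp only [sq_abs]

end Cesaro

/-! ### From abstract darts to basis states of the walk. -/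

/-- Extension of a function by zero along an injection. -/
noncomputable def zeroExt {D I : Type*} (j : D → I) (x : D → ℝ) (i : I) : ℝ :=
  (Function.partialInv j i).elim 0 x

section ZeroExt

variable {D I : Type*} {j : D → I} (hj : Function.Injective j)
include hj

theorem zeroExt_apply (x : D → ℝ) (d : D) : zeroExt j x (j d) = x d := by
  rw [zeroExt, Function.partialInv_left hj, Option.elim_some]

theorem exists_of_zeroExt_ne_zero {x : D → ℝ} {i : I} (h : zeroExt j x i ≠ 0) :
    ∃ d, j d = i ∧ x d ≠ 0 := by
  rcases hi : Function.partialInv j i with _ | d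
  · rw [zeroExt, hi] at h
    exact absurd rfl h
  · refine ⟨d, (hj.isPartialInv d i).1 hi, ?_⟩
    rwa [zeroExt, hi] at h

theorem sum_eq_sum_of_zeroExt [Fintype D] [Fintype I] {x : D → ℝ} {F : I → ℝ}
    (h : ∀ d, F (j d) = x d) (h0 : ∀ i, (∀ d, j d ≠ i) → F i = 0) : ∑ i, F i = ∑ d, x d := by
  refine (Fintype.sum_of_injective j hj x F (fun i hi => h0 i fun d hd => hi ⟨d, hd⟩) fun d =>
    (h d).symm).symm

theorem zeroExt_of_forall_ne {x : D → ℝ} {i : I} (h : ∀ d, j d ≠ i) : zeroExt j x i = 0 := by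
  by_contra h0
  obtain ⟨d, hd, -⟩ := exists_of_zeroExt_ne_zero hj h0
  exact h d hd

/-- States that encode no dart share the label `none`, and the extension vanishes there;
orthogonality on the fibres thus carries over from darts. -/
theorem fibre_sum_zeroExt [Fintype D] [Fintype I] {N : Type*} [DecidableEq N] (lab : D → N)
    {x φ : D → ℝ} {F : I → ℝ} (hF : ∀ d, F (j d) = x d)
    (h : ∀ c, ∑ d with lab d = c, x d * φ d = 0) (i : I) :
    ∑ l with (Function.partialInv j l).map lab = (Function.partialInv j i).map lab,
      (F l : ℂ) * (zeroExt j φ l : ℂ) = 0 := by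
  have h3 : ∑ l with (Function.partialInv j l).map lab = (Function.partialInv j i).map lab,
      F l * zeroExt j φ l = 0 := by
    rw [Finset.sum_filter]
    rcases hi : Function.partialInv j i with _ | d'
    · refine Finset.sum_eq_zero fun l _ => ?_
      split_ifs with h4
      · rw [zeroExt_of_forall_ne hj, mul_zero]
        rintro d rfl
        simp [Function.partialInv_left hj] at h4
      · rfl
    · have h' := h (lab d')
      rw [Finset.sum_filter] at h'
      refine Eq.trans ?_ h'
      refine sum_eq_sum_of_zeroExt hj (fun d => ?_) fun l hl => ?_
      · simp [Function.partialInv_left hj, hF, zeroExt_apply hj]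
      · rw [zeroExt_of_forall_ne hj hl, mul_zero, ite_self]
  exact_mod_cast congrArg (fun r : ℝ => (r : ℂ)) h3

end ZeroExt

/-- A quantum walk on darts. Darts with the same node sit at one vertex, darts with the same edge
sit at one vertex or at two adjacent vertices. -/
theorem exists_robot_of_darts {V : Type*} [Fintype V] [DecidableEq V] (G : SimpleGraph V)
    {D N N' : Type*} [Fintype D] [DecidableEq D] [DecidableEq N] [DecidableEq N']
    (pos : D → V) (node : D → N) (edge : D → N') (a : D → ℝ) (test : D → Bool) (d₀ : D)
    (ha : a d₀ ≠ 0)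
    (hnode : ∀ d d', node d = node d' → pos d = pos d')
    (hedge : ∀ d, (∃ v, ∀ d', edge d = edge d' → pos d' = v) ∨
      ∃ v w, G.Adj v w ∧ ∀ d', edge d = edge d' → pos d' = v ∨ pos d' = w) (s : ℕ) :
    ∃ A : Robot G, ∀ X : V → Bool,
      ((∀ d, test d = true → X (pos d) = false) →
        A.prob (pos d₀) (2 * (2 ^ s + 1)) X true ≤ (∑ d, a d ^ 2) / a d₀ ^ 2 / (2 ^ s) ^ 2) ∧
      ∀ φ : D → ℝ,
        (∀ c, ∑ d with node d = c, (if X (pos d) && test d then 0 else a d) * φ d = 0) →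
        (∀ c, ∑ d with edge d = c, (if d = d₀ then 0 else a d) * φ d = 0) →
        φ d₀ ^ 2 ≤ (∑ d, φ d ^ 2) * A.prob (pos d₀) (2 * (2 ^ s + 1)) X true := by
  -- The walk register needs a power of two as its size and enough room to number all darts.
  have hcard : Fintype.card D ≤ Fintype.card (Fin (2 ^ Fintype.card D)) := by
    rw [Fintype.card_fin]
    exact Nat.lt_two_pow_self.le
  obtain ⟨δ⟩ := Function.Embedding.nonempty_of_card_le hcard
  set j : D → V × Fin (2 ^ Fintype.card D) := fun d => (pos d, δ d) with hjdef
  have hj : Function.Injective j := fun d d' h => δ.injective (congrArg Prod.snd h)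
  -- The dangling dart belongs to no edge, so the edge reflection fixes it.
  set b : D → ℝ := fun d => if d = d₀ then 0 else a d with hb
  set inv := Function.partialInv j
  have hinv : ∀ d, inv (j d) = some d := Function.partialInv_left hj
  set tst : V × Fin (2 ^ Fintype.card D) → Bool := fun i => (inv i).elim false test
  have htst : ∀ d, tst (j d) = test d := fun d => by simp [tst, hinv]
  set f : V × Fin (2 ^ Fintype.card D) → Option N := fun i => (inv i).map node
  have hf : ∀ d, f (j d) = some (node d) := fun d => by simp [f, hinv]
  set g : V × Fin (2 ^ Fintype.card D) → Option N' := fun i => (inv i).map edge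
  have hg : ∀ d, g (j d) = some (edge d) := fun d => by simp [g, hinv]
  obtain ⟨A, hA⟩ := exists_robot_phase_detection (f := f) (a := zeroExt j a) (g := g)
    (b := zeroExt j b) (test := tst) (i₀ := j d₀) G (Fintype.card_fin _) s
    (by
      intro i i' hi hi' h
      obtain ⟨d, rfl, -⟩ := exists_of_zeroExt_ne_zero hj hi
      obtain ⟨d', rfl, -⟩ := exists_of_zeroExt_ne_zero hj hi'
      rw [hf, hf] at h
      exact hnode d d' (Option.some_injective _ h))
    (by
      intro i hi
      obtain ⟨d, rfl, -⟩ := exists_of_zeroExt_ne_zero hj hi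
      rcases hedge d with ⟨v, hv⟩ | ⟨v, w, hvw, hv⟩
      · refine Or.inl ⟨v, fun i' hi' h => ?_⟩
        obtain ⟨d', rfl, -⟩ := exists_of_zeroExt_ne_zero hj hi'
        rw [hg, hg] at h
        exact hv d' (Option.some_injective _ h)
      · refine Or.inr ⟨v, w, hvw, fun i' hi' h => ?_⟩
        obtain ⟨d', rfl, -⟩ := exists_of_zeroExt_ne_zero hj hi'
        rw [hg, hg] at h
        exact hv d' (Option.some_injective _ h))
  refine ⟨A, fun X => ⟨fun hX => ?_, fun φ h1 h2 => ?_⟩⟩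
  · have hstar : starAmp (zeroExt j a) tst X = zeroExt j a := by
      ext i
      by_cases hi : ∃ d, j d = i
      · obtain ⟨d, rfl⟩ := hi
        rw [starAmp, htst, if_neg]
        rw [Bool.and_eq_true]
        rintro ⟨h1, h2⟩
        exact absurd (hX d h2) (by simp [hjdef] at h1; simp [h1])
      · push Not at hi
        rw [starAmp, zeroExt_of_forall_ne hj hi, ite_self]
    set e₀ : V × Fin (2 ^ Fintype.card D) → ℂ := Pi.single (j d₀) 1
    set w : V × Fin (2 ^ Fintype.card D) → ℂ := fun i => (zeroExt j b i : ℂ) * ((a d₀)⁻¹ : ℝ)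
    have haw : (fun i => (zeroExt j a i : ℂ) * ((a d₀)⁻¹ : ℝ)) = w + e₀ := by
      ext i
      simp only [w, e₀, Pi.add_apply]
      by_cases hi : ∃ d, j d = i
      · obtain ⟨d, rfl⟩ := hi
        rw [zeroExt_apply hj, zeroExt_apply hj, Pi.single_apply, hb]
        by_cases hd : d = d₀
        · subst hd
          simp [ha]
        · simp [hd, hj.eq_iff]
      · push Not at hi
        rw [zeroExt_of_forall_ne hj hi, zeroExt_of_forall_ne hj hi,
          Pi.single_eq_of_ne (hi d₀).symm]
        simp
    have hB : blockRefl g (zeroExt j b) *ᵥ w = -w :=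
      blockRefl_mulVec_of_proportional fun _ => (((a d₀)⁻¹ : ℝ) : ℂ)
    have hA' : blockRefl f (zeroExt j a) *ᵥ (w + e₀) = -(w + e₀) := by
      rw [← haw]
      exact blockRefl_mulVec_of_proportional fun _ => (((a d₀)⁻¹ : ℝ) : ℂ)
    have hB0 : blockRefl g (zeroExt j b) *ᵥ e₀ = e₀ := by
      refine blockRefl_mulVec_of_orthogonal fun i => Finset.sum_eq_zero fun l _ => ?_
      by_cases hl : l = j d₀
      · rw [hl, zeroExt_apply hj, hb]
        simp
      · simp [e₀, hl]
    -- The edge reflection sends `w - e₀` to `-(w + e₀)`, and the star reflection negates this,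
    -- because `w + e₀` is the full star vector scaled to 1 at the root dart.
    have hU : walkMatrix f (zeroExt j a) tst g (zeroExt j b) X *ᵥ (w - e₀)
        = (w - e₀) + (2 : ℂ) • e₀ := by
      rw [walkMatrix, hstar, ← Matrix.mulVec_mulVec, Matrix.mulVec_sub, hB, hB0,
        show -w - e₀ = -(w + e₀) by abel, Matrix.mulVec_neg, hA', two_smul]
      abel
    rw [hA]
    refine (sum_norm_sq_cesaro_le (mul_mem blockRefl_mem_unitaryGroup blockRefl_mem_unitaryGroup)
      hU).trans (le_of_eq ?_)
    rw [Nat.cast_pow, Nat.cast_ofNat, Finset.sum_div (s := Finset.univ) (f := fun d => a d ^ 2)]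
    congr 1
    refine sum_eq_sum_of_zeroExt hj (fun d => ?_) fun i hi => ?_
    · simp only [w, e₀, Pi.sub_apply, zeroExt_apply hj, Pi.single_apply, hb]
      by_cases hd : d = d₀
      · subst hd
        simp [ha]
      · simp [hd, hj.eq_iff, div_eq_mul_inv, mul_pow]
    · simp only [w, e₀, Pi.sub_apply, zeroExt_of_forall_ne hj hi,
        Pi.single_eq_of_ne (hi d₀).symm]
      simp
  · have hφ : (fun i => (zeroExt j φ i : ℂ)) ᵥ* walkMatrix f (zeroExt j a) tst g (zeroExt j b) X
        = fun i => (zeroExt j φ i : ℂ) := by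
      rw [← Matrix.mulVec_transpose, walkMatrix, Matrix.transpose_mul, blockRefl_transpose,
        blockRefl_transpose, ← Matrix.mulVec_mulVec,
        blockRefl_mulVec_of_orthogonal (fibre_sum_zeroExt hj node
          (fun d => by rw [starAmp, htst, zeroExt_apply hj]) h1),
        blockRefl_mulVec_of_orthogonal (fibre_sum_zeroExt hj edge (zeroExt_apply hj b) h2)]
    have h3 := sq_le_mul_sum_norm_sq_cesaro (i₀ := j d₀) (M := 2 ^ s) (by positivity) hφ
    rw [zeroExt_apply hj] at h3
    rw [hA]
    convert h3 using 2
    refine (sum_eq_sum_of_zeroExt hj (fun d => ?_) fun i hi => ?_).symm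
    · rw [zeroExt_apply hj]
    · rw [zeroExt_of_forall_ne hj hi, zero_pow two_ne_zero]

/-! ### Electric networks, flows and detection of marked leaves. -/

section Network

variable {P Hub : Type*} [DecidableEq Hub] (src tgt : P → Hub) (len : P → ℕ)

/-- The `j`-th node of the path `p` of a network: the ends of the path are hubs. -/
def pathNode (p : P) (j : ℕ) : Hub ⊕ (P × ℕ) :=
  if j = 0 then Sum.inl (src p) else if j = len p then Sum.inl (tgt p) else Sum.inr (p, j)

/-- The darts of a network: a dangling dart at the root, and two darts for every edge of a path. -/
abbrev Dart (len : P → ℕ) : Type _ := Option (Σ p : P, Fin (len p) × Bool)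

def dartNode (root : Hub) : Dart len → Hub ⊕ (P × ℕ)
  | none => Sum.inl root
  | some ⟨p, j, y⟩ => pathNode src tgt len p (if y then j + 1 else j)

def dartEdge : Dart len → Option (P × ℕ)
  | none => none
  | some ⟨p, j, _⟩ => some (p, j)

/-- The function on darts with value `c` at the dangling dart, and `x p`, `y p` at the two darts of
every edge of the path `p`. -/
def dartFun (c : ℝ) (x y : P → ℝ) : Dart len → ℝ
  | none => c
  | some ⟨p, _, b⟩ => if b then y p else x p

variable [Fintype P]

theorem sum_dart (F : Dart len → ℝ) :
    ∑ d, F d = F none + ∑ p, ∑ j : Fin (len p), (F (some ⟨p, j, false⟩) + F (some ⟨p, j, true⟩)) := by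
  rw [Fintype.sum_option, Fintype.sum_sigma]
  congr 1
  refine Finset.sum_congr rfl fun p _ => ?_
  rw [Fintype.sum_prod_type]
  refine Finset.sum_congr rfl fun j _ => ?_
  rw [Fintype.sum_bool, add_comm]

theorem sum_dartFun (c : ℝ) (x y : P → ℝ) :
    ∑ d, dartFun len c x y d = c + ∑ p, len p * (x p + y p) := by
  rw [sum_dart]
  simp [dartFun, mul_add]

variable {src tgt len}

/-- Net outflow at a node: along each path the contributions telescope to its two ends. -/
theorem sum_dartNode_eq [DecidableEq P] (hlen : ∀ p, 1 ≤ len p) (root : Hub) (f : P → ℝ) (c) :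
    ∑ d with dartNode src tgt len root d = c, dartFun len (-1) f (-f) d
      = (∑ p, ((if Sum.inl (src p) = c then f p else 0) - if Sum.inl (tgt p) = c then f p else 0))
        - if Sum.inl root = c then 1 else 0 := by
  rw [Finset.sum_filter, sum_dart, add_comm, sub_eq_add_neg]
  congr 1
  · refine Finset.sum_congr rfl fun p _ => ?_
    have h : ∀ j : Fin (len p),
        ((if dartNode src tgt len root (some ⟨p, j, false⟩) = c then
            dartFun len (-1) f (-f) (some ⟨p, j, false⟩) else 0) +
          if dartNode src tgt len root (some ⟨p, j, true⟩) = c then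
            dartFun len (-1) f (-f) (some ⟨p, j, true⟩) else 0)
        = (fun j : ℕ => (if pathNode src tgt len p j = c then f p else 0) -
          if pathNode src tgt len p (j + 1) = c then f p else 0) j := by
      intro j
      simp only [dartNode, dartFun, Bool.false_eq_true, if_false, if_true, Pi.neg_apply]
      split_ifs <;> ring
    rw [Finset.sum_congr rfl fun j _ => h j,
      Fin.sum_univ_eq_sum_range (fun j : ℕ => (if pathNode src tgt len p j = c then f p else 0) -
          if pathNode src tgt len p (j + 1) = c then f p else 0), Finset.sum_range_sub',
      show pathNode src tgt len p 0 = Sum.inl (src p) from if_pos rfl,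
      show pathNode src tgt len p (len p) = Sum.inl (tgt p) by
        rw [pathNode, if_neg (by have := hlen p; omega), if_pos rfl]]
  · have h : dartNode src tgt len root none = Sum.inl root := rfl
    rw [h]
    split_ifs <;> simp [dartFun]

end Network

/-- Detection of marked leaves of an electric network mapped to the graph: if the input marks no
leaf the robot answers `true` only with small probability, which is governed by the total
weight of the network; if there is a flow of small energy from the root to the marked leaves it
answers `true` with large probability. -/
theorem exists_robot_of_network {V : Type*} [Fintype V] [DecidableEq V] (G : SimpleGraph V)
    {P Hub : Type*} [Fintype P] [DecidableEq P] [DecidableEq Hub] (loc : Hub → V)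
    (src tgt : P → Hub) (len : P → ℕ) (hlen : ∀ p, 1 ≤ len p) (path : P → ℕ → V)
    (hsrc : ∀ p, path p 0 = loc (src p)) (htgt : ∀ p, path p (len p) = loc (tgt p))
    (hadj : ∀ p j, j < len p → path p j = path p (j + 1) ∨ G.Adj (path p j) (path p (j + 1)))
    (wt : P → ℝ) (hwt : ∀ p, 0 < wt p) (root : Hub) (leaf : Hub → Bool) {w₀ : ℝ} (hw₀ : 0 < w₀)
    (s : ℕ) :
    ∃ A : Robot G, ∀ X : V → Bool,
      ((∀ x, leaf x = true → X (loc x) = false) →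
        A.prob (loc root) (2 * (2 ^ s + 1)) X true
          ≤ (w₀ + 2 * ∑ p, len p * wt p) / w₀ / (2 ^ s) ^ 2) ∧
      ∀ f : P → ℝ, (∀ x, ¬ (leaf x = true ∧ X (loc x) = true) →
          ∑ p with src p = x, f p - ∑ p with tgt p = x, f p = if x = root then 1 else 0) →
        1 / w₀ ≤ (1 / w₀ + 2 * ∑ p, len p * (f p ^ 2 / wt p)) *
          A.prob (loc root) (2 * (2 ^ s + 1)) X true := by
  set nodeLoc : Hub ⊕ (P × ℕ) → V := Sum.elim loc fun q => path q.1 q.2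
  set node := dartNode src tgt len root
  have hloc : ∀ p j, nodeLoc (pathNode src tgt len p j) = path p j := by
    intro p j
    rw [pathNode]
    split_ifs with h1 h2
    · rw [h1]
      exact (hsrc p).symm
    · rw [h2]
      exact (htgt p).symm
    · rfl
  have hw₀' : √w₀ ≠ 0 := (Real.sqrt_pos.2 hw₀).ne'
  have hwt' : ∀ p, √(wt p) ≠ 0 := fun p => (Real.sqrt_pos.2 (hwt p)).ne'
  obtain ⟨A, hA⟩ := exists_robot_of_darts G (fun d => nodeLoc (node d)) node (dartEdge len)
    (dartFun len (√w₀) (fun p => √(wt p)) fun p => √(wt p))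
    (fun d => Sum.elim leaf (fun _ => false) (node d)) none hw₀'
    (fun d d' h => by rw [h])
    (by
      rintro (_ | ⟨p, j, y⟩)
      · refine Or.inl ⟨loc root, ?_⟩
        rintro (_ | ⟨p, j, y⟩) h
        · rfl
        · simp [dartEdge] at h
      · have key : ∀ d', dartEdge len (some ⟨p, j, y⟩) = dartEdge len d' →
            nodeLoc (node d') = path p j ∨ nodeLoc (node d') = path p (j + 1) := by
          rintro (_ | ⟨p', j', y'⟩) h
          · simp [dartEdge] at h
          · simp only [dartEdge, Option.some.injEq, Prod.mk.injEq] at h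
            obtain ⟨rfl, h⟩ := h
            rw [h]
            rcases y' with _ | _
            · exact Or.inl (hloc _ _)
            · exact Or.inr (hloc _ _)
        rcases hadj p j j.2 with h | h
        · refine Or.inl ⟨path p j, fun d' hd' => ?_⟩
          rcases key d' hd' with h' | h'
          · exact h'
          · exact h'.trans h.symm
        · exact Or.inr ⟨_, _, h, key⟩) s
  refine ⟨A, fun X => ⟨fun hX => ?_, fun f hf => ?_⟩⟩
  · refine ((hA X).1 fun d hd => ?_).trans (le_of_eq ?_)
    · rcases hn : node d with x | q
      · rw [hn] at hd
        exact hX x hd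
      · rw [hn] at hd
        simp at hd
    · have h1 : ∀ d, dartFun len (√w₀) (fun p => √(wt p)) (fun p => √(wt p)) d ^ 2
          = dartFun len w₀ wt wt d := by
        rintro (_ | ⟨p, j, y⟩)
        · exact Real.sq_sqrt hw₀.le
        · rcases y with _ | _ <;> exact Real.sq_sqrt (hwt p).le
      rw [h1, Finset.sum_congr rfl fun d _ => h1 d, sum_dartFun, Finset.mul_sum]
      simp only [dartFun]
      congr 3
      refine Finset.sum_congr rfl fun p _ => ?_
      ring
  -- Opposite signs on the two darts give orthogonality on edges. Multiplying by the star amplitudes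
  -- cancels the roots, so orthogonality at a node is conservation of flow, with the dangling dart
  -- supplying the unit at the root.
  · have h2 := (hA X).2 (dartFun len (-(√w₀)⁻¹) (fun p => f p / √(wt p)) fun p => -f p / √(wt p))
      ?_ ?_
    · have h1 : ∀ d, dartFun len (-(√w₀)⁻¹) (fun p => f p / √(wt p)) (fun p => -f p / √(wt p)) d ^ 2
          = dartFun len (1 / w₀) (fun p => f p ^ 2 / wt p) (fun p => f p ^ 2 / wt p) d := by
        rintro (_ | ⟨p, j, y⟩)
        · simp only [dartFun]
          rw [neg_sq, inv_pow, Real.sq_sqrt hw₀.le, one_div]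
        · rcases y with _ | _ <;> simp [dartFun, div_pow, Real.sq_sqrt (hwt p).le]
      rw [h1, Finset.sum_congr rfl fun d _ => h1 d, sum_dartFun] at h2
      rw [Finset.mul_sum]
      refine h2.trans (le_of_eq ?_)
      congr 2
      refine Finset.sum_congr rfl fun p _ => ?_
      ring
    · have h1 : ∀ d, dartFun len (√w₀) (fun p => √(wt p)) (fun p => √(wt p)) d *
          dartFun len (-(√w₀)⁻¹) (fun p => f p / √(wt p)) (fun p => -f p / √(wt p)) d
          = dartFun len (-1) f (-f) d := by
        rintro (_ | ⟨p, j, y⟩)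
        · simp [dartFun, hw₀']
        · have := hwt' p
          rcases y with _ | _ <;> simp [dartFun] <;> field_simp
      intro c
      by_cases hc : X (nodeLoc c) && Sum.elim leaf (fun _ => false) c
      · refine Finset.sum_eq_zero fun d hd => ?_
        rw [(Finset.mem_filter.1 hd).2, if_pos hc, zero_mul]
      · rw [Finset.sum_congr rfl fun d hd => by
          rw [(Finset.mem_filter.1 hd).2, if_neg hc, h1], sum_dartNode_eq hlen, sub_eq_zero]
        rcases c with x | q
        · simp only [Sum.inl.injEq]
          rw [Finset.sum_sub_distrib, ← Finset.sum_filter, ← Finset.sum_filter, hf]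
          · simp only [eq_comm]
          · rintro ⟨h, h'⟩
            exact hc (by simp [nodeLoc, h, h'])
        · simp
    · intro c
      rw [Finset.sum_filter, sum_dart]
      simp only [if_true, zero_mul, ite_self, zero_add]
      refine Finset.sum_eq_zero fun p _ => Finset.sum_eq_zero fun j _ => ?_
      simp only [dartEdge, dartFun]
      split_ifs <;> simp_all [neg_div]

/-! ### Lazy paths and flows in trees. -/

/-- Two vertices at distance at most `l` are joined by a lazy path of length exactly `l`. -/
theorem exists_lazy_path {V : Type*} {G : SimpleGraph V} (hG : G.Connected) {u v : V} {l : ℕ}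
    (h : G.dist u v ≤ l) :
    ∃ path : ℕ → V, path 0 = u ∧ path l = v ∧
      ∀ j, path j = path (j + 1) ∨ G.Adj (path j) (path (j + 1)) := by
  obtain ⟨w, hw⟩ := hG.exists_walk_length_eq_dist u v
  refine ⟨w.getVert, w.getVert_zero, w.getVert_of_length_le (hw.trans_le h), fun j => ?_⟩
  by_cases hj : j < w.length
  · exact Or.inr (w.adj_getVert_succ hj)
  · left
    rw [w.getVert_of_length_le (by omega), w.getVert_of_length_le (by omega)]

/-- The `i`-th ancestor of a vertex. -/
def ancestor {V : Type*} (par : ℕ → V → V) : ℕ → V → V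
  | 0, x => x
  | i + 1, x => par i (ancestor par i x)

theorem ancestor_mem {V : Type*} {par : ℕ → V → V} {S : ℕ → Finset V} {L : ℕ}
    (hpar : ∀ i < L, ∀ c ∈ S i, par i c ∈ S (i + 1)) {x : V} (hx : x ∈ S 0) {i : ℕ} (hi : i ≤ L) :
    ancestor par i x ∈ S i := by
  induction i with
  | zero => exact hx
  | succ i ih => exact hpar i (by omega) _ (ih (by omega))

section Flow

variable {V : Type*} [DecidableEq V] (par : ℕ → V → V) (S : ℕ → Finset V) (L : ℕ) (Y : Finset V)

/-- The flow in a tree that moves the same amount from the root to every leaf in `Y`. -/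
noncomputable def treeFlow (p : Σ i : Fin L, S i) : ℝ :=
  (Y.card : ℝ)⁻¹ * ∑ y ∈ Y, if ancestor par p.1 y = p.2 then 1 else 0

variable {par S L Y} (hpar : ∀ i < L, ∀ c ∈ S i, par i c ∈ S (i + 1)) (hY : Y ⊆ S 0)
include hpar hY

/-- A weighted sum of the flow is the average, over the leaves in `Y`, of the weights along the path
to the root. -/
theorem sum_mul_treeFlow (F : (Σ i : Fin L, S i) → ℝ) (F' : ℕ → V → ℝ)
    (hF : ∀ p, F p = F' p.1 p.2) :
    ∑ p, F p * treeFlow par S L Y p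
      = (Y.card : ℝ)⁻¹ * ∑ y ∈ Y, ∑ i ∈ Finset.range L, F' i (ancestor par i y) := by
  have h1 : ∀ p, F p * treeFlow par S L Y p = (Y.card : ℝ)⁻¹ *
      ∑ y ∈ Y, if ancestor par p.1 y = p.2 then F p else 0 := by
    intro p
    rw [treeFlow, mul_left_comm, Finset.mul_sum]
    simp
  rw [Finset.sum_congr rfl fun p _ => h1 p, ← Finset.mul_sum, Finset.sum_comm]
  congr 1
  refine Finset.sum_congr rfl fun y hy => ?_
  rw [Fintype.sum_sigma, Finset.sum_range]
  refine Finset.sum_congr rfl fun i _ => ?_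
  rw [Fintype.sum_eq_single ⟨ancestor par i y, ancestor_mem hpar (hY hy) i.2.le⟩]
  · simp [hF]
  · rintro ⟨c, hc⟩ hne
    rw [if_neg]
    rintro h
    exact hne (Subtype.ext h.symm)

/-- The path of each leaf telescopes: its top term is the root, and `hx` removes its bottom term. -/
theorem treeFlow_conservation (hY0 : Y.Nonempty) {v₁ : V} (hL : S L = {v₁}) (x : ℕ × V)
    (hx : ¬ (x.1 = 0 ∧ x.2 ∈ Y)) :
    ∑ p : Σ i : Fin L, S i with ((p.1 : ℕ) + 1, par p.1 p.2) = x, treeFlow par S L Y p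
      - ∑ p : Σ i : Fin L, S i with ((p.1 : ℕ), (p.2 : V)) = x, treeFlow par S L Y p
      = if x = (L, v₁) then 1 else 0 := by
  have hc : (Y.card : ℝ) ≠ 0 := by exact_mod_cast hY0.card_ne_zero
  have h1 := sum_mul_treeFlow hpar hY
    (fun p => (if ((p.1 : ℕ) + 1, par p.1 p.2) = x then 1 else 0)
      - if ((p.1 : ℕ), (p.2 : V)) = x then 1 else 0)
    (fun i c => (if (i + 1, par i c) = x then 1 else 0) - if (i, c) = x then 1 else 0)
    fun p => rfl
  rw [Finset.sum_filter, Finset.sum_filter, ← Finset.sum_sub_distrib]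
  refine Eq.trans (Finset.sum_congr rfl fun p _ => ?_) (h1.trans ?_)
  · rw [sub_mul, ite_mul, ite_mul, one_mul, zero_mul]
  · have h2 : ∀ y ∈ Y, ∑ i ∈ Finset.range L,
        ((if (i + 1, par i (ancestor par i y)) = x then (1 : ℝ) else 0)
          - if (i, ancestor par i y) = x then 1 else 0) = if x = (L, v₁) then 1 else 0 := by
      intro y hy
      refine (Finset.sum_range_sub (fun i => if (i, ancestor par i y) = x then (1 : ℝ) else 0)
        L).trans ?_
      have h3 : ancestor par L y = v₁ := by
        have := ancestor_mem hpar (hY hy) le_rfl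
        rwa [hL, Finset.mem_singleton] at this
      have h4 : (0, ancestor par 0 y) ≠ x := by
        rintro rfl
        exact hx ⟨rfl, hy⟩
      rw [h3, if_neg h4, sub_zero]
      simp only [eq_comm]
    rw [Finset.sum_congr rfl h2, Finset.sum_const, nsmul_eq_mul, inv_mul_cancel_left₀ hc]

/-- The flows across a level are nonnegative with sum 1, so the sum of their squares is at most the
largest of them. -/
theorem sum_treeFlow_sq_le (hY0 : Y.Nonempty) {i : Fin L} {μ : ℝ}
    (hμ0 : (i : ℕ) = 0 → (Y.card : ℝ)⁻¹ ≤ μ) (hμ : (i : ℕ) ≠ 0 → 1 ≤ μ) :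
    ∑ c : S i, treeFlow par S L Y ⟨i, c⟩ ^ 2 ≤ μ := by
  have hc : (0 : ℝ) < Y.card := by exact_mod_cast hY0.card_pos
  have hsum : ∑ c : S i, treeFlow par S L Y ⟨i, c⟩ = 1 := by
    simp only [treeFlow]
    rw [← Finset.mul_sum, Finset.sum_comm, Finset.sum_congr rfl (g := fun _ => (1 : ℝ))]
    · simp [hc.ne']
    · intro y hy
      rw [Fintype.sum_eq_single ⟨ancestor par i y, ancestor_mem hpar (hY hy) i.2.le⟩]
      · simp
      · rintro ⟨c, hc⟩ hne
        rw [if_neg]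
        rintro h
        exact hne (Subtype.ext h.symm)
  have hnonneg : ∀ p, 0 ≤ treeFlow par S L Y p := fun p =>
    mul_nonneg (inv_nonneg.2 hc.le) (Finset.sum_nonneg fun y _ => by split_ifs <;> norm_num)
  have hle : ∀ c : S i, treeFlow par S L Y ⟨i, c⟩ ≤ μ := by
    intro c
    by_cases hi : (i : ℕ) = 0
    · refine le_trans ?_ (hμ0 hi)
      refine mul_le_of_le_one_right (inv_nonneg.2 hc.le) ?_
      simp only [hi, ancestor]
      rw [Finset.sum_ite_eq']
      split_ifs <;> norm_num
    · refine le_trans ?_ (hμ hi)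
      rw [← hsum]
      exact Finset.single_le_sum (fun c _ => hnonneg ⟨i, c⟩) (Finset.mem_univ c)
  calc ∑ c : S i, treeFlow par S L Y ⟨i, c⟩ ^ 2
      ≤ ∑ c : S i, μ * treeFlow par S L Y ⟨i, c⟩ := Finset.sum_le_sum fun c _ => by
        rw [sq]
        exact mul_le_mul_of_nonneg_right (hle c) (hnonneg _)
    _ = μ := by rw [← Finset.mul_sum, hsum, mul_one]

end Flow

/-! ### Search through a tree with balanced weights. -/

/-- With the weight √(μ/ν), the energy bound of a level (here) and its total weight (next lemma) are
both √(μν) per unit length. -/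
theorem div_sqrt_div_eq_sqrt_mul {μ ν : ℝ} (hμ : 0 < μ) (hν : 0 < ν) : μ / √(μ / ν) = √(μ * ν) := by
  rw [div_eq_iff (Real.sqrt_pos.2 (div_pos hμ hν)).ne', ← Real.sqrt_mul (by positivity),
    show μ * ν * (μ / ν) = μ ^ 2 by field_simp, Real.sqrt_sq hμ.le]

theorem mul_sqrt_div_eq_sqrt_mul {μ ν : ℝ} (hμ : 0 < μ) (hν : 0 < ν) : ν * √(μ / ν) = √(μ * ν) := by
  rw [← Real.sqrt_sq hν.le, ← Real.sqrt_mul (by positivity), Real.sqrt_sq hν.le]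
  congr 1
  field_simp

/-- Spatial search through a tree of vertices with leaves `H`: `S i` is the set of the vertices at
height `i`, and `par i` maps it to `S (i + 1)`, moving by at most `len i`. -/
theorem exists_robot_of_tree {V : Type*} [Fintype V] [DecidableEq V] {G : SimpleGraph V}
    (hG : G.Connected) (v₁ : V) {H : Finset V} {k : ℕ} (hk : 1 ≤ k) {L : ℕ} (hL : 1 ≤ L)
    {S : ℕ → Finset V} {par : ℕ → V → V} {len : ℕ → ℕ} {ν μ : ℕ → ℝ}
    (hpar : ∀ i < L, ∀ c ∈ S i, par i c ∈ S (i + 1)) (hS0 : S 0 = H) (hSL : S L = {v₁})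
    (hlen : ∀ i < L, 1 ≤ len i) (hdist : ∀ i < L, ∀ c ∈ S i, G.dist (par i c) c ≤ len i)
    (hν : ∀ i < L, ((S i).card : ℝ) ≤ ν i) (hν0 : ∀ i < L, 0 < ν i)
    (hμ0 : μ 0 = (k : ℝ)⁻¹) (hμ : ∀ i ≠ 0, μ i = 1) :
    ∃ (T : ℕ) (A : Robot G), A.Computes v₁ T (orAtLeast H k) ∧
      (T : ℝ) ≤ 20 * (∑ i ∈ Finset.range L, len i * √(μ i * ν i)) + 10 := by
  set Z : ℝ := ∑ i ∈ Finset.range L, len i * √(μ i * ν i)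
  have hk' : (0 : ℝ) < k := by exact_mod_cast hk
  have hμpos : ∀ i, 0 < μ i := by
    intro i
    by_cases hi : i = 0
    · rw [hi, hμ0]
      positivity
    · rw [hμ i hi]
      exact one_pos
  have hZ : 0 < Z := by
    refine Finset.sum_pos (fun i hi => ?_) ⟨0, Finset.mem_range.2 hL⟩
    rw [Finset.mem_range] at hi
    have h1 : (0 : ℝ) < len i := by exact_mod_cast hlen i hi
    exact mul_pos h1 (Real.sqrt_pos.2 (mul_pos (hμpos i) (hν0 i hi)))
  have hpath : ∀ p : Σ i : Fin L, S i, ∃ path : ℕ → V, path 0 = par p.1 p.2 ∧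
      path (len p.1) = p.2 ∧ ∀ j, path j = path (j + 1) ∨ G.Adj (path j) (path (j + 1)) :=
    fun p => exists_lazy_path hG (hdist p.1 p.1.2 p.2 p.2.2)
  choose path hpath0 hpath1 hpath2 using hpath
  set wt : (Σ i : Fin L, S i) → ℝ := fun p => √(μ p.1 / ν p.1)
  have hwt : ∀ p, 0 < wt p := fun p => Real.sqrt_pos.2 (div_pos (hμpos _) (hν0 _ p.1.2))
  have hW : ∑ p : Σ i : Fin L, S i, (len p.1 : ℝ) * wt p ≤ Z := by
    rw [Fintype.sum_sigma]
    simp only [Z, wt, Finset.sum_range]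
    refine Finset.sum_le_sum fun i _ => ?_
    rw [Finset.sum_const, Finset.card_univ, Fintype.card_coe, nsmul_eq_mul,
      ← mul_sqrt_div_eq_sqrt_mul (hμpos i) (hν0 i i.2), mul_left_comm]
    exact mul_le_mul_of_nonneg_left (mul_le_mul_of_nonneg_right (hν i i.2) (Real.sqrt_nonneg _))
      (Nat.cast_nonneg _)
  -- The lower bound gives error at most 1/3 when nothing is marked, as `1 + 8 Z² ≤ (5 Z + 2)² / 3`;
  -- the upper bound gives `20 Z + 10` steps.
  obtain ⟨s, hs1, hs2⟩ : ∃ s : ℕ, 5 * Z + 2 ≤ (2 : ℝ) ^ s ∧ (2 : ℝ) ^ s ≤ 2 * (5 * Z + 2) := by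
    obtain ⟨s, hs1, hs2⟩ := exists_nat_pow_near (by linarith : 1 ≤ 5 * Z + 2) one_lt_two
    refine ⟨s + 1, hs2.le, ?_⟩
    rw [pow_succ]
    linarith
  -- Hubs record their level, so a vertex occurring on several levels gives distinct nodes. The
  -- choice of `w₀` turns the marked case into `4 Z ≤ (4 Z + 2 Z) p`, that is, `p ≥ 2/3`.
  obtain ⟨A, hA⟩ := exists_robot_of_network G (loc := Prod.snd)
    (src := fun p : Σ i : Fin L, S i => ((p.1 : ℕ) + 1, par p.1 p.2))
    (tgt := fun p => ((p.1 : ℕ), (p.2 : V))) (len := fun p => len p.1)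
    (fun p => hlen p.1 p.1.2) path hpath0 hpath1 (fun p j _ => hpath2 p j) wt hwt (L, v₁)
    (fun x => decide (x.1 = 0)) (w₀ := 1 / (4 * Z)) (by positivity) s
  refine ⟨2 * (2 ^ s + 1), A, fun X y hy => ?_, ?_⟩
  · rw [orAtLeast] at hy
    split_ifs at hy with h1 h2
    · have hy : y = false := (Option.some_injective _ hy).symm
      subst hy
      rw [A.prob_false]
      have h3 := (hA X).1 fun x _ => by
        by_contra h
        have : x.2 ∈ marked X := by simpa [marked] using h
        simp [h1] at this
      have h4 : (1 / (4 * Z) + 2 * ∑ p : Σ i : Fin L, S i, (len p.1 : ℝ) * wt p) / (1 / (4 * Z))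
          / (2 ^ s) ^ 2 ≤ 1 / 3 := by
        rw [div_le_iff₀ (by positivity), div_le_iff₀ (by positivity)]
        have h5 : (5 * Z + 2) ^ 2 ≤ ((2 : ℝ) ^ s) ^ 2 := pow_le_pow_left₀ (by positivity) hs1 2
        have h6 : 1 / 3 * (5 * Z + 2) ^ 2 * (1 / (4 * Z)) ≤ 1 / 3 * (2 ^ s) ^ 2 * (1 / (4 * Z)) := by
          gcongr
        refine le_trans ?_ h6
        rw [mul_one_div, le_div_iff₀ (by positivity), add_mul, one_div_mul_cancel (by positivity)]
        nlinarith
      exact le_sub_comm.1 ((h3.trans h4).trans (by norm_num))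
    · have hy : y = true := (Option.some_injective _ hy).symm
      subst hy
      have hne : (marked X).Nonempty := Finset.nonempty_iff_ne_empty.2 h1
      have hsub : marked X ⊆ S 0 := hS0 ▸ h2.1
      have h3 := (hA X).2 (treeFlow par S L (marked X)) fun x hx =>
        treeFlow_conservation hpar hsub hne hSL x fun h => hx
          ⟨by simpa using h.1, by simpa [marked] using h.2⟩
      have hE : ∑ p : Σ i : Fin L, S i, (len p.1 : ℝ) * (treeFlow par S L (marked X) p ^ 2 / wt p)
          ≤ Z := by
        rw [Fintype.sum_sigma]
        simp only [Z, wt, Finset.sum_range]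
        refine Finset.sum_le_sum fun i _ => ?_
        rw [← Finset.mul_sum, ← Finset.sum_div, ← div_sqrt_div_eq_sqrt_mul (hμpos i) (hν0 i i.2)]
        refine mul_le_mul_of_nonneg_left (div_le_div_of_nonneg_right ?_ (Real.sqrt_nonneg _))
          (Nat.cast_nonneg _)
        refine sum_treeFlow_sq_le hpar hsub hne (fun hi => ?_) fun hi => (hμ i hi).ge
        rw [hi, hμ0]
        exact inv_anti₀ hk' (by exact_mod_cast h2.2)
      have hp : 0 ≤ A.prob v₁ (2 * (2 ^ s + 1)) X true :=
        Finset.sum_nonneg fun b _ => sq_nonneg _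
      rw [one_div_one_div] at h3
      have h4 : 4 * Z ≤ (6 * Z) * A.prob v₁ (2 * (2 ^ s + 1)) X true :=
        h3.trans (mul_le_mul_of_nonneg_right (by linarith) hp)
      nlinarith
  · push_cast
    linarith

/-! ### Nets, volume growth and the sum over scales. -/

/-- A maximal family of vertices with pairwise distances greater than `2 ρ`. -/
theorem exists_net {V : Type*} [Fintype V] [DecidableEq V] (G : SimpleGraph V) (ρ : ℕ) :
    ∃ N : Finset V, (∀ c ∈ N, ∀ c' ∈ N, c ≠ c' → 2 * ρ < G.dist c c') ∧
      ∀ v, ∃ c ∈ N, G.dist c v ≤ 2 * ρ := by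
  classical
  obtain ⟨N, hN, hmax⟩ := Finset.exists_max_image
    ((Finset.univ : Finset (Finset V)).filter fun N =>
      ∀ c ∈ N, ∀ c' ∈ N, c ≠ c' → 2 * ρ < G.dist c c') Finset.card ⟨∅, by simp⟩
  simp only [Finset.mem_filter, Finset.mem_univ, true_and] at hN hmax
  refine ⟨N, hN, fun v => ?_⟩
  by_contra! hv
  have hvN : v ∉ N := fun h => by simpa using hv v h
  have := hmax (insert v N) fun c hc c' hc' hne => by
    rcases Finset.mem_insert.1 hc with h1 | h1 <;> rcases Finset.mem_insert.1 hc' with h2 | h2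
    · exact absurd (h1.trans h2.symm) hne
    · rw [h1, G.dist_comm]
      exact hv _ h2
    · rw [h2]
      exact hv _ h1
    · exact hN _ h1 _ h2 hne
  rw [Finset.card_insert_of_notMem hvN] at this
  omega

/-- The packing bound for separated sets. -/
theorem card_mul_le_of_separated {V : Type*} [Fintype V] {G : SimpleGraph V} {d κ : ℝ}
    (hG : IsDimensional d κ G) {ρ : ℕ} {N : Finset V}
    (hN : ∀ c ∈ N, ∀ c' ∈ N, c ≠ c' → 2 * ρ < G.dist c c')
    (hρ : κ * (ρ : ℝ) ^ d ≤ Fintype.card V) :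
    (N.card : ℝ) * (κ * (ρ : ℝ) ^ d) ≤ Fintype.card V := by
  classical
  set B : V → Finset V := fun c => Finset.univ.filter fun w => G.dist c w ≤ ρ
  have hB : ∀ c, κ * (ρ : ℝ) ^ d ≤ (B c).card := by
    intro c
    have h := hG.growth c ρ
    rw [min_eq_left hρ] at h
    refine h.trans (le_of_eq ?_)
    rw [← Set.ncard_coe_finset]
    simp [B]
  have hdisj : ∀ c ∈ N, ∀ c' ∈ N, c ≠ c' → Disjoint (B c) (B c') := by
    intro c hc c' hc' hne
    rw [Finset.disjoint_left]
    intro w hw hw'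
    simp only [B, Finset.mem_filter, Finset.mem_univ, true_and] at hw hw'
    have h1 := hG.connected.dist_triangle (u := c) (v := w) (w := c')
    have h2 := hN c hc c' hc' hne
    rw [G.dist_comm (u := w)] at h1
    omega
  calc (N.card : ℝ) * (κ * (ρ : ℝ) ^ d) = ∑ c ∈ N, κ * (ρ : ℝ) ^ d := by
        rw [Finset.sum_const, nsmul_eq_mul]
    _ ≤ ∑ c ∈ N, ((B c).card : ℝ) := Finset.sum_le_sum fun c _ => hB c
    _ = ((N.biUnion B).card : ℝ) := by rw [Finset.card_biUnion hdisj, Nat.cast_sum]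
    _ ≤ Fintype.card V := by exact_mod_cast Finset.card_le_univ _

theorem dist_le_of_card_le {V : Type*} [Fintype V] {G : SimpleGraph V} {d κ : ℝ}
    (hG : IsDimensional d κ G) {ρ : ℕ} (hρ : (Fintype.card V : ℝ) ≤ κ * (ρ : ℝ) ^ d) (v w : V) :
    G.dist v w ≤ ρ := by
  have h := hG.growth v ρ
  rw [min_eq_right hρ, ← Nat.card_eq_fintype_card, ← Set.ncard_univ] at h
  have h1 : {w : V | G.dist v w ≤ ρ} = Set.univ :=
    Set.eq_of_subset_of_ncard_le (Set.subset_univ _) (by exact_mod_cast h)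
  exact Set.eq_univ_iff_forall.1 h1 w

theorem sum_scales_le {D₀ r κ β R : ℝ} (hr : 0 < r) (hκ : 0 < κ) (hβ : 0 < β) (hβ1 : 2 * β < 1)
    (hD : 0 ≤ D₀) (hR : D₀ ≤ 2 * R) {L : ℕ} (hL : 1 ≤ L) {a : ℕ → ℝ} (h0 : a 0 = r)
    (ha : ∀ i ≠ 0, a i = r / κ * (β ^ i) ^ 2) :
    ∑ i ∈ Finset.range L, 2 * (2 ^ (i + 1) * D₀) * √(a i)
      ≤ 8 * (1 + (√κ)⁻¹ * (1 - 2 * β)⁻¹) * (R * √r) := by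
  have hterm : ∀ i, 2 * (2 ^ (i + 1) * D₀) * √(a i)
      -- The leaf level contributes the separate 1; above it lengths grow by 2 and square roots
      -- shrink by `β`, hence the ratio `2 * β`.
      ≤ 4 * D₀ * √r * ((if i = 0 then 1 else 0) + (√κ)⁻¹ * (2 * β) ^ i) := by
    intro i
    by_cases hi : i = 0
    · subst hi
      rw [h0, if_pos rfl, pow_zero, mul_one, zero_add, pow_one]
      have : 0 ≤ D₀ * √r * (√κ)⁻¹ := by positivity
      linarith
    · rw [ha i hi, if_neg hi, Real.sqrt_mul (by positivity), Real.sqrt_sq (by positivity),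
        Real.sqrt_div hr.le, mul_pow, pow_succ]
      refine le_of_eq ?_
      ring
  have hgeom : ∑ i ∈ Finset.range L, (2 * β) ^ i ≤ (1 - 2 * β)⁻¹ := by
    rw [← tsum_geometric_of_lt_one (by positivity) hβ1]
    exact (summable_geometric_of_lt_one (by positivity) hβ1).sum_le_tsum _
      fun i _ => by positivity
  calc _ ≤ ∑ i ∈ Finset.range L, 4 * D₀ * √r * ((if i = 0 then 1 else 0) + (√κ)⁻¹ * (2 * β) ^ i) :=
        Finset.sum_le_sum fun i _ => hterm i
    _ = 4 * D₀ * √r * (1 + (√κ)⁻¹ * ∑ i ∈ Finset.range L, (2 * β) ^ i) := by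
      rw [← Finset.mul_sum, Finset.sum_add_distrib, Finset.mul_sum, Finset.sum_ite_eq',
        if_pos (Finset.mem_range.2 hL)]
    _ ≤ 4 * (2 * R) * √r * (1 + (√κ)⁻¹ * (1 - 2 * β)⁻¹) := by
      have : 0 ≤ 2 * R := hD.trans hR
      have : 0 ≤ ∑ i ∈ Finset.range L, (2 * β) ^ i := Finset.sum_nonneg fun i _ => by positivity
      gcongr
    _ = _ := by ring

theorem exists_robot_orAtLeast {d κ : ℝ} (hd : 2 < d) (hκ : 0 < κ) :
    ∃ C : ℝ, 0 < C ∧ ∀ (V : Type*) [Fintype V] [DecidableEq V] (G : SimpleGraph V),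
      IsDimensional d κ G → ∀ (v₁ : V) (H : Finset V) (k : ℕ), 1 ≤ k → k ≤ H.card →
        ∃ (T : ℕ) (A : Robot G), A.Computes v₁ T (orAtLeast H k) ∧
          (T : ℝ) ≤ C * (Fintype.card V : ℝ) ^ (1 / d)
            * ((H.card : ℝ) / (k : ℝ)) ^ (1 / 2 - 1 / d) := by
  -- The factor by which the root of the net size shrinks when the scale doubles; `2 * β < 1` is
  -- exactly where `d > 2` enters.
  set β : ℝ := 2 ^ (-(d / 2)) with hβdef
  have hβ : 0 < β := by positivity
  have hβ1 : 2 * β < 1 := by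
    have h : β < 2 ^ (-1 : ℝ) := Real.rpow_lt_rpow_of_exponent_lt one_lt_two (by linarith)
    rw [Real.rpow_neg_one] at h
    linarith
  have hβd : β ^ 2 * 2 ^ d = 1 := by
    rw [hβdef, ← Real.rpow_natCast, ← Real.rpow_mul zero_le_two, ← Real.rpow_add two_pos]
    norm_num
  set E : ℝ := 8 * (1 + (√κ)⁻¹ * (1 - 2 * β)⁻¹)
  have hE : 0 ≤ E := by
    have : 0 < 1 - 2 * β := by linarith
    positivity
  refine ⟨20 * E + 10, by positivity, fun V _ _ G hG v₁ H k hk hkH => ?_⟩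
  set n : ℝ := (Fintype.card V : ℝ)
  set r : ℝ := (H.card : ℝ) / k
  have hk0 : (0 : ℝ) < k := by exact_mod_cast hk
  have hkH' : (k : ℝ) ≤ H.card := by exact_mod_cast hkH
  have hr1 : 1 ≤ r := (one_le_div hk0).2 hkH'
  have hr0 : 0 < r := by linarith
  have hH0 : (0 : ℝ) < H.card := by linarith
  have hrn : r ≤ n := (div_le_self hH0.le (by exact_mod_cast hk)).trans
    (Nat.cast_le.2 (Finset.card_le_univ H))
  have hn0 : 0 < n := by linarith
  set R : ℝ := (n / r) ^ (1 / d)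
  have hd0 : 0 < d := by linarith
  have hR1 : 1 ≤ R := Real.one_le_rpow ((one_le_div hr0).2 hrn) (by positivity)
  have hRd : R ^ d = n / r := by
    rw [← Real.rpow_mul (by positivity), one_div_mul_cancel hd0.ne', Real.rpow_one]
  have hRr : R * √r = n ^ (1 / d) * r ^ (1 / 2 - 1 / d) := by
    rw [Real.sqrt_eq_rpow, Real.rpow_sub hr0, show R = (n / r) ^ (1 / d) from rfl, Real.div_rpow hn0.le hr0.le]
    ring
  set D₀ : ℕ := ⌈R⌉₊
  have hD₀ : R ≤ D₀ := Nat.le_ceil R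
  have hD₀' : (D₀ : ℝ) ≤ 2 * R := by
    have := Nat.ceil_lt_add_one (by linarith : 0 ≤ R)
    linarith
  set D : ℕ → ℕ := fun i => 2 ^ i * D₀
  have hD₀1 : (1 : ℝ) ≤ D₀ := hR1.trans hD₀
  -- The least such level `L` is the top: a ball of radius `D L` is all of `V`, so `v₁` can serve as
  -- the only node. Below `L` the growth bound is not truncated by `n`, so packing applies.
  have hex : ∃ i, 1 ≤ i ∧ n ≤ κ * (D i : ℝ) ^ d := by
    obtain ⟨i, hi⟩ := pow_unbounded_of_one_lt (n / κ) one_lt_two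
    refine ⟨i + 1, by omega, ?_⟩
    rw [div_lt_iff₀' hκ] at hi
    refine hi.le.trans (mul_le_mul_of_nonneg_left ?_ hκ.le)
    have h1 : (2 : ℝ) ^ i ≤ D (i + 1) := by
      simp only [D]
      push_cast
      rw [pow_succ]
      nlinarith [pow_pos (two_pos : (0 : ℝ) < 2) i]
    have h2 : (1 : ℝ) ≤ D (i + 1) := (one_le_pow₀ one_le_two).trans h1
    exact h1.trans (Real.self_le_rpow_of_one_le h2 (by linarith))
  classical
  set L := Nat.find hex
  obtain ⟨hL1, hLn⟩ : 1 ≤ L ∧ n ≤ κ * (D L : ℝ) ^ d := Nat.find_spec hex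
  have hlt : ∀ i, 1 ≤ i → i < L → κ * (D i : ℝ) ^ d ≤ n := by
    intro i hi hiL
    have := Nat.find_min hex hiL
    by_contra h
    exact this ⟨hi, (not_le.1 h).le⟩
  choose net hsep hnet using fun ρ => exists_net G ρ
  set S : ℕ → Finset V := fun i => if i = 0 then H else if i < L then net (D i) else {v₁}
  have hSpos : ∀ i, S (i + 1) = if i + 1 < L then net (D (i + 1)) else {v₁} := fun i =>
    if_neg (Nat.succ_ne_zero i)
  have hpar : ∀ i v, ∃ c, i < L → c ∈ S (i + 1) ∧ G.dist c v ≤ 2 * D (i + 1) := by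
    intro i v
    rw [hSpos]
    by_cases hi : i + 1 < L
    · obtain ⟨c, hc, hcv⟩ := hnet (D (i + 1)) v
      exact ⟨c, fun _ => ⟨by rwa [if_pos hi], hcv⟩⟩
    · refine ⟨v₁, fun hiL => ⟨by rw [if_neg hi]; exact Finset.mem_singleton_self _, ?_⟩⟩
      rw [show i + 1 = L by omega]
      exact (dist_le_of_card_le hG hLn v₁ v).trans (by omega)
  choose par hpar using hpar
  set ν : ℕ → ℝ := fun i => if i = 0 then H.card else r / κ * (β ^ i) ^ 2
  set μ : ℕ → ℝ := fun i => if i = 0 then (k : ℝ)⁻¹ else 1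
  have hν : ∀ i < L, ((S i).card : ℝ) ≤ ν i := by
    intro i hi
    by_cases hi0 : i = 0
    · simp [S, ν, hi0]
    · have h1 := card_mul_le_of_separated hG (hsep (D i)) (hlt i (by omega) hi)
      simp only [S, ν, if_neg hi0, if_pos hi]
      -- As `R ^ d = n / r`, the packing bound `n / (κ D_i ^ d)` is at most `r / κ * 2 ^ (-i d)`.
      have h2 : (2 ^ d) ^ i * (n / r) ≤ (D i : ℝ) ^ d := by
        rw [← hRd, Real.rpow_pow_comm zero_le_two, ← Real.mul_rpow (by positivity) (by positivity)]
        refine Real.rpow_le_rpow (by positivity) ?_ hd0.le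
        simp only [D]
        push_cast
        gcongr
      have h3 : ((net (D i)).card : ℝ) * (κ * ((2 ^ d) ^ i * (n / r))) ≤ n := by
        refine le_trans ?_ h1
        gcongr
      have h4 : (β ^ i) ^ 2 * (2 ^ d) ^ i = 1 := by
        rw [← pow_mul, mul_comm i 2, pow_mul, ← mul_pow, hβd, one_pow]
      calc ((net (D i)).card : ℝ)
          = ((net (D i)).card : ℝ) * (κ * ((2 ^ d) ^ i * (n / r))) * (r / κ * (β ^ i) ^ 2 / n) := by
            field_simp
            rw [mul_assoc, mul_comm _ ((β ^ i) ^ 2), h4, mul_one]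
        _ ≤ n * (r / κ * (β ^ i) ^ 2 / n) := mul_le_mul_of_nonneg_right h3 (by positivity)
        _ = _ := by field_simp
  obtain ⟨T, A, hA, hT⟩ := exists_robot_of_tree hG.connected v₁ (H := H) hk hL1 (S := S) (par := par)
    (len := fun i => 2 * D (i + 1)) (ν := ν) (μ := μ) (fun i hi c _ => (hpar i c hi).1) (if_pos rfl)
    ((if_neg (by omega)).trans (if_neg (lt_irrefl L)))
    (fun i _ => by
      have : 0 < 2 ^ (i + 1) * D₀ := by positivity
      simp only [D]
      omega)
    (fun i hi c _ => (hpar i c hi).2) hν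
    (fun i _ => by
      simp only [ν]
      split_ifs <;> positivity)
    (if_pos rfl) fun i hi => if_neg hi
  refine ⟨T, A, hA, ?_⟩
  have hZ : ∑ i ∈ Finset.range L, ((2 * D (i + 1) : ℕ) : ℝ) * √(μ i * ν i) ≤ E * (R * √r) := by
    refine le_trans (le_of_eq (Finset.sum_congr rfl fun i _ => ?_))
      (sum_scales_le hr0 hκ hβ hβ1 (Nat.cast_nonneg D₀) hD₀' hL1 (a := fun i => μ i * ν i) ?_ ?_)
    · simp only [D]
      push_cast
      rfl
    · simp only [μ, ν, if_true, r]
      field_simp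
    · intro i hi
      simp only [μ, ν, if_neg hi, one_mul]
  have h1 : 1 ≤ R * √r := one_le_mul_of_one_le_of_one_le hR1 (Real.one_le_sqrt.2 hr1)
  rw [mul_assoc, ← hRr]
  linarith

end SpatialSearch

/-! ### The bound on the query complexity. -/

theorem mainTheorem10 (d κ : ℝ) (hd : 2 < d) (hκ : 0 < κ) :
    ∃ (C : ℝ) (c : ℕ), 0 < C ∧
      ∀ (V : Type*) [Fintype V] [DecidableEq V] (G : SimpleGraph V),
        SpatialSearch.IsDimensional d κ G →
        ∀ (v₁ : V) (H : Finset V) (k : ℕ), 1 ≤ k → k ≤ H.card →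
          ∃ T : ℕ,
            SpatialSearch.queryComplexity (SpatialSearch.orAtLeast H k) G v₁ = (T : ℕ∞) ∧
            (T : ℝ) ≤ C * (Fintype.card V : ℝ) ^ (1 / d)
              * ((H.card : ℝ) / (k : ℝ)) ^ (1 / 2 - 1 / d)
              * Real.log (2 + (H.card : ℝ) / (k : ℝ)) ^ c := by
  obtain ⟨C, hC, h⟩ := SpatialSearch.exists_robot_orAtLeast hd hκ
  -- The logarithm gets exponent 0.
  refine ⟨C, 0, hC, fun V _ _ G hG v₁ H k hk hkH => ?_⟩
  obtain ⟨T, A, hA, hT⟩ := h V G hG v₁ H k hk hkH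
  have hle : SpatialSearch.queryComplexity (SpatialSearch.orAtLeast H k) G v₁ ≤ (T : ℕ∞) :=
    iInf₂_le T ⟨A, hA⟩
  obtain ⟨T', hT', hle'⟩ := ENat.le_natCast_iff.1 hle
  refine ⟨T', hT', ?_⟩
  rw [pow_zero, mul_one]
  exact le_trans (by exact_mod_cast hle') hT
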